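/- Let $T>0$, $e\in\mathbb N_0$, and let $g:\mathbb R^e\times\mathbb R^e\to\mathbb R$ be a symmetric positive semidefinite kernel with reproducing kernel Hilbert space $\mathcal H_g$. Assume that $g$ is four times differentiable in each variable and that, for all $0\le n,m\le 4$, $$\sup_{x,y\in\mathbb R^e}\Big(\sum_{|I|=n,\,|J|=m}\big|\partial_{x^I}^n\partial_{y^J}^m g(x,y)\big|^2\Big)^{1/2}<\infty .$$ For $t\in[0,T]$ let $\mathrm{BV}_t$ be the space of continuous paths $[t,T]\to\mathbb R^e$ of bounded variation. For $\gamma\in\mathrm{BV}_t$ let $\gamma^g_u=G(\gamma)_u=g(\gamma_u,\cdot)\in\mathcal H_g$, $u\in[t,T]$, and let $S(\gamma^g)_{t,r}$ be the signature of $\gamma^g$ on $[t,r]$, i.e. the sequence of its iterated Stieltjes integrals $\int_{t<u_1<\dots<u_n<r}d\gamma^g_{u_1}\otimes\cdots\otimes d\gamma^g_{u_n}\in\mathcal H_g^{\otimes n}$, $n\ge0$ (Hilbert tensor powers). For $\gamma\in\mathrm{BV}_t$, $\tau\in\mathrm{BV}_s$, $r\in[t,T]$, $q\in[s,T]$ define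 the lifted signature kernel $$\kappa(\gamma,\tau)_{r,q}=\big\langle S(\gamma^g)_{t,r},S(\tau^g)_{s,q}\big\rangle=\sum_{n\ge0}\big\langle S(\gamma^g)^{n}_{t,r},S(\tau^g)^{n}_{s,q}\big\rangle_{\mathcal H_g^{\otimes n}} .$$ For a function $f$ of $\gamma$ and directions $\eta,\bar\eta\in\mathrm{BV}_t$ write $\partial_\gamma^\eta f(\gamma)=\lim_{\varepsilon\to0}\varepsilon^{-1}\big(f(\gamma+\varepsilon\eta)-f(\gamma)\big)$ and $\partial_\gamma^{\eta\bar\eta}f(\gamma)=\lim_{\varepsilon\to0}\varepsilon^{-1}\big(\partial_\gamma^\eta f(\gamma+\varepsilon\bar\eta)-\partial_\gamma^\eta f(\gamma)\big)$; for $G$ these limits are taken in $\mathcal H_g$ at each time $u$. Let $s,t\in[0,T]$, $\gamma\in\mathrm{BV}_t$, $\tau\in\mathrm{BV}_s$. Then $\gamma^g$ and $\tau^g$ are continuous of bounded variation, their signatures are square-summable over $n$, $\kappa(\gamma,\tau)$ is continuous on $[t,T]\times[s,T]$, and the following hold. 1. For every $\eta\in\mathrm{BV}_t$, the derivatives $\partial_\gamma^\eta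 G(\gamma)_u$ and $\partial_\gamma^\eta\kappa(\gamma,\tau)_{r,q}$ exist for all $u,r\in[t,T]$, $q\in[s,T]$; $\partial_\gamma^\eta G(\gamma)$ is a continuous $\mathcal H_g$-valued path of bounded variation, $(r,q)\mapsto\partial_\gamma^\eta\kappa(\gamma,\tau)_{r,q}$ is continuous, and $$\partial_\gamma^\eta\kappa(\gamma,\tau)_{r,q}=\int_s^{q}\!\int_t^{r}\Big(\partial_\gamma^\eta\kappa(\gamma,\tau)_{u,v}\,\langle d\gamma^g_u,d\tau^g_v\rangle_{\mathcal H_g}+\kappa(\gamma,\tau)_{u,v}\,\langle d\,\partial_\gamma^\eta G(\gamma)_u,d\tau^g_v\rangle_{\mathcal H_g}\Big).$$ 2. For all $\eta,\bar\eta\in\mathrm{BV}_t$, the second derivatives $\partial_\gamma^{\eta\bar\eta}G(\gamma)_u$ and $\partial_\gamma^{\eta\bar\eta}\kappa(\gamma,\tau)_{r,q}$ exist for all $u,r\in[t,T]$, $q\in[s,T]$; $\partial_\gamma^{\eta\bar\eta}G(\gamma)$ is a continuous $\mathcal H_g$-valued path of bounded variation, $(r,q)\mapsto\partial_\gamma^{\eta\bar\eta}\kappa(\gamma,\tau)_{r,q}$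 is continuous, and $$\begin{aligned}\partial_\gamma^{\eta\bar\eta}\kappa(\gamma,\tau)_{r,q}=\int_s^{q}\!\int_t^{r}\Big(&\partial_\gamma^{\eta\bar\eta}\kappa(\gamma,\tau)_{u,v}\langle d\gamma^g_u,d\tau^g_v\rangle_{\mathcal H_g}+\partial_\gamma^{\eta}\kappa(\gamma,\tau)_{u,v}\langle d\,\partial_\gamma^{\bar\eta}G(\gamma)_u,d\tau^g_v\rangle_{\mathcal H_g}\\&+\partial_\gamma^{\bar\eta}\kappa(\gamma,\tau)_{u,v}\langle d\,\partial_\gamma^{\eta}G(\gamma)_u,d\tau^g_v\rangle_{\mathcal H_g}+\kappa(\gamma,\tau)_{u,v}\langle d\,\partial_\gamma^{\eta\bar\eta}G(\gamma)_u,d\tau^g_v\rangle_{\mathcal H_g}\Big).\end{aligned}$$ -/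

import Mathlib

open MeasureTheory Set
open scoped TensorProduct

noncomputable section

namespace SigKernel

/-! ### Bounded variation paths and Stieltjes integration -/

/-- `γ` restricted to `[a, b]` is a continuous path of bounded variation.  Paths are represented by
functions on `ℝ`; everything below only looks at their values on `[a, b]`. -/
def IsBVPath {E : Type*} [NormedAddCommGroup E] (a b : ℝ) (γ : ℝ → E) : Prop :=
  ContinuousOn γ (Icc a b) ∧ BoundedVariationOn γ (Icc a b)

/-- The path which is `γ` on `[a, b]` and is extended by constants outside of `[a, b]`. -/
def clamp {E : Type*} (a b : ℝ) (γ : ℝ → E) : ℝ → E :=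
  fun u => γ (max a (min u b))

open Classical in
/-- The Stieltjes vector measure `dγ` of a bounded variation path `γ` on `[a, b]` (and `0` if the
path does not have bounded variation). -/
def dPath {E : Type*} [NormedAddCommGroup E] [CompleteSpace E] (a b : ℝ) (γ : ℝ → E) :
    VectorMeasure ℝ E :=
  if h : BoundedVariationOn (clamp a b γ) univ then h.vectorMeasure else 0

/-! ### Hilbert tensor powers and the signature -/

/-- A real Hilbert space, bundled. -/
structure HilbertSpaceCat where
  carrier : Type
  [normedAddCommGroup : NormedAddCommGroup carrier]
  [innerProductSpace : InnerProductSpace ℝ carrier]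
  [completeSpace : CompleteSpace carrier]

attribute [instance] HilbertSpaceCat.normedAddCommGroup HilbertSpaceCat.innerProductSpace
  HilbertSpaceCat.completeSpace

variable (H : Type) [NormedAddCommGroup H] [InnerProductSpace ℝ H] [CompleteSpace H]

/-- The Hilbert space `H^{⊗ n}`: the completion of the algebraic tensor power for the inner product
`⟨a₁ ⊗ ⋯ ⊗ aₙ, b₁ ⊗ ⋯ ⊗ bₙ⟩ = ∏ᵢ ⟨aᵢ, bᵢ⟩`, with `H^{⊗ 0} = ℝ`. -/
def tensorPow : ℕ → HilbertSpaceCat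
  | 0 => ⟨ℝ⟩
  | n + 1 => ⟨UniformSpace.Completion ((tensorPow n).carrier ⊗[ℝ] H)⟩

/-- `H^{⊗ n}` as a type. -/
abbrev TPow (n : ℕ) : Type := (tensorPow H n).carrier

/-- The bilinear map `(a, h) ↦ a ⊗ h` from `H^{⊗ n} × H` to `H^{⊗ (n + 1)}`. -/
def tensorMul (n : ℕ) : TPow H n →L[ℝ] H →L[ℝ] TPow H (n + 1) :=
  (ContinuousLinearMap.compL ℝ H (TPow H n ⊗[ℝ] H)
    (UniformSpace.Completion (TPow H n ⊗[ℝ] H)) UniformSpace.Completion.toComplL).comp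
      (TensorProduct.mkL ℝ (TPow H n) H)

/-- The unit of `H^{⊗ 0} = ℝ`. -/
def tensorOne : TPow H 0 := (1 : ℝ)

variable {H}

/-- The signature of a path `X` on `[a, b]`: `signature a b X n r` is the component of degree `n`
of `S(X)_{a,r}`, the iterated Stieltjes integral
`∫_{a < u₁ < ⋯ < uₙ ≤ r} dX_{u₁} ⊗ ⋯ ⊗ dX_{uₙ}`, defined recursively by
`S(X)^{n+1}_{a,r} = ∫_a^r S(X)^n_{a,u} ⊗ dX_u`. -/
def signature (a b : ℝ) (X : ℝ → H) : (n : ℕ) → ℝ → TPow H n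
  | 0 => fun _ => tensorOne H
  | n + 1 => fun r =>
      ((dPath a b X).restrict (Ioc a r)).integral (signature a b X n) (tensorMul H n)

/-- The (doubly indexed) signature kernel `⟨S(X)_{t,r}, S(Y)_{s,q}⟩` of a path `X` on `[t, T]`
and a path `Y` on `[s, T]`, the inner product being that of the Hilbert direct sum of the
tensor powers. -/
def sigKernel (T t s : ℝ) (X Y : ℝ → H) (r q : ℝ) : ℝ :=
  ∑' n, inner ℝ (signature t T X n r) (signature s T Y n q)

/-- The double Stieltjes integral `∫_s^q ∫_t^r F(u, v) ⟨dX_u, dY_v⟩` for a path `X` on `[t, T]` and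
a path `Y` on `[s, T]`. -/
def doubleIntegral (T t s : ℝ) (F : ℝ → ℝ → ℝ) (X Y : ℝ → H) (r q : ℝ) : ℝ :=
  ((dPath s T Y).restrict (Ioc s q)).integral
    (fun v => ((dPath t T X).restrict (Ioc t r)).integral (fun u => F u v)
      (ContinuousLinearMap.lsmul ℝ ℝ))
    (innerSL ℝ)

/-! ### Static kernels -/

/-- The state space `ℝ^e`. -/
abbrev V (e : ℕ) : Type := EuclideanSpace ℝ (Fin e)

variable {e : ℕ}

/-- The partial derivative `∂_{x^i} f (x, y)`. -/
def partialX (i : Fin e) (f : V e → V e → ℝ) : V e → V e → ℝ :=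
  fun x y => lineDeriv ℝ (fun x' => f x' y) x (EuclideanSpace.single i 1)

/-- The partial derivative `∂_{y^j} f (x, y)`. -/
def partialY (j : Fin e) (f : V e → V e → ℝ) : V e → V e → ℝ :=
  fun x y => lineDeriv ℝ (fun y' => f x y') y (EuclideanSpace.single j 1)

/-- The mixed partial derivative `∂_{x^I} ∂_{y^J} g`. -/
def mixedPartial (g : V e → V e → ℝ) (I J : List (Fin e)) : V e → V e → ℝ :=
  I.foldr partialX (J.foldr partialY g)

/-- The standing assumption on the static kernel: `g` is four times differentiable in each of its
variables, that is, the mixed derivatives `∂_{x^I} ∂_{y^J} g` with `|I|, |J| ≤ 4` exist, and for all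
`n, m ≤ 4`
`sup_{x, y} (∑_{|I| = n, |J| = m} |∂_{x^I} ∂_{y^J} g(x, y)|²)^{1/2} < ∞`. -/
structure StaticKernelAssumption (g : V e → V e → ℝ) : Prop where
  differentiable_y : ∀ J : List (Fin e), J.length < 4 →
    ∀ x, Differentiable ℝ (fun y => mixedPartial g [] J x y)
  differentiable_x : ∀ I J : List (Fin e), I.length < 4 → J.length ≤ 4 →
    ∀ y, Differentiable ℝ (fun x => mixedPartial g I J x y)
  bounded : ∀ n ≤ 4, ∀ m ≤ 4, BddAbove (range fun p : V e × V e =>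
    Real.sqrt (∑ I : Fin n → Fin e, ∑ J : Fin m → Fin e,
      |mixedPartial g (List.ofFn I) (List.ofFn J) p.1 p.2| ^ 2))

/-! ### Lifted paths, the lifted signature kernel and their Gateaux derivatives -/

variable (H) [RKHS ℝ H (V e) ℝ]

/-- The lift `G(γ) = γ^g` of `γ`, i.e. `G(γ)_u = g(γ_u, ·) ∈ H` where `g` is the kernel of `H`. -/
def lift (γ : ℝ → V e) : ℝ → H := fun u => RKHS.kerFun H (γ u) 1

/-- The Gateaux derivative `∂_γ^η G(γ)`. -/
def dLift (η γ : ℝ → V e) : ℝ → H :=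
  fun u => lineDeriv ℝ (fun γ' => lift H γ' u) γ η

/-- The second Gateaux derivative `∂_γ^{η η'} G(γ)`, the derivative in direction `η'` of
`∂_γ^η G(γ)`. -/
def ddLift (η η' γ : ℝ → V e) : ℝ → H :=
  fun u => lineDeriv ℝ (fun γ' => dLift H η γ' u) γ η'

/-- The `g`-lifted signature kernel `κ^g(γ, τ)_{r,q} = ⟨S(γ^g)_{t,r}, S(τ^g)_{s,q}⟩`. -/
def liftedKernel (T t s : ℝ) (τ : ℝ → V e) (γ : ℝ → V e) (r q : ℝ) : ℝ :=
  sigKernel T t s (lift H γ) (lift H τ) r q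

/-- The Gateaux derivative `∂_γ^η κ^g(γ, τ)_{r,q}`. -/
def dLiftedKernel (T t s : ℝ) (τ η : ℝ → V e) (γ : ℝ → V e) (r q : ℝ) : ℝ :=
  lineDeriv ℝ (fun γ' => liftedKernel H T t s τ γ' r q) γ η

/-- The second Gateaux derivative `∂_γ^{η η'} κ^g(γ, τ)_{r,q}`, the derivative in direction `η'` of
`∂_γ^η κ^g(γ, τ)_{r,q}`. -/
def ddLiftedKernel (T t s : ℝ) (τ η η' : ℝ → V e) (γ : ℝ → V e) (r q : ℝ) : ℝ :=
  lineDeriv ℝ (fun γ' => dLiftedKernel H T t s τ η γ' r q) γ η'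

end SigKernel

end

/-!
The signature kernel is the resolvent of a Volterra operator, and the theorem is the formula for the
derivative of a resolvent.

For paths `X` on `[t, T]` and `Y` on `[s, T]` let `I_X` be the operator
`I_X F (r, q) = ∫_s^q ∫_t^r F(u, v) ⟨dX_u, dY_v⟩` on the Banach space of continuous functions on
`[t, T] × [s, T]` (`volterra`). The inner product of two iterated integrals of order `n + 1` is the
double integral of the inner products of those of order `n` (`inner_signature_succ`), so
`⟨S(X)ⁿ, S(Y)ⁿ⟩ = I_Xⁿ 1`. Since `‖I_Xⁿ‖ ≤ cⁿ / n!` (`norm_volterra_pow_le`), the signature kernel is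
`κ = ∑ I_Xⁿ 1 = (1 - I_X)⁻¹ 1` (`hasSum_sigKernel`); the case `X = Y` gives the square summability of
the signature.

The operator `I_X` is linear in `X` and bounded by the total variation of `X`. Thus, if a family of
paths `X_ε` is differentiable at `0` for the total variation norm, with derivative `X'`, then `I_{X_ε}`
is differentiable for the operator norm, with derivative `I_{X'}` (`hasExpansion_volterra`), and
`A = (1 - I_X)⁻¹` has the derivative `A I_{X'} A`. With `I = I_{γ^g}`, and `I_η`, `I_{η η'}` for the
operators of the derivatives of the lift, this gives `∂^η κ = A I_η κ`, that is
`∂^η κ = I ∂^η κ + I_η κ`, and by the product rule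
`∂^{η η'} κ = A (I_{η'} ∂^η κ + I_{η η'} κ + I_η ∂^{η'} κ)`.

What remains is the differentiability of the lift for the total variation norm. The lift of `γ` is
`φ ∘ γ` for the feature map `φ x = g(x, ·)`. Squared norms of finite differences of `φ` are mixed
finite differences of `g`, so the bounds on the derivatives of `g` bound the finite differences of `φ` up to
order four (`exists_diffBound_feature`). A function with bounded differences of order `n + 2` has a
derivative with bounded differences of order `n + 1` (`DiffBound.exists_hasFDerivAt`), and the
increments of its Taylor remainder are of second order (`norm_taylorRem_sub_le`). Hence the lift has the
first and second derivatives `φ'(γ) η` and `φ''(γ) η' η`, with remainders of order `ε²` in total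
variation.
-/

noncomputable section

namespace SigKernel

/-! ### Iterated finite differences -/

section FiniteDifferences

open Filter Topology

variable {W E E' : Type*} [NormedAddCommGroup W] [NormedAddCommGroup E] [NormedAddCommGroup E']

/-- The iterated finite difference `Δ_{h₁} ⋯ Δ_{hₙ} f` along a list `[h₁, …, hₙ]` of increments,
where `Δ_h f (x) = f (x + h) - f x`. -/
def iterDiff (f : W → E) (hs : List W) : W → E :=
  hs.foldl (fun f h => fwdDiff h f) f

@[simp] lemma iterDiff_nil (f : W → E) : iterDiff f [] = f := rfl

@[simp] lemma iterDiff_cons (f : W → E) (h : W) (hs : List W) :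
    iterDiff f (h :: hs) = iterDiff (fwdDiff h f) hs := rfl

lemma map_iterDiff {F : Type*} [FunLike F E E'] [AddMonoidHomClass F E E'] (L : F) (f : W → E)
    (hs : List W) (x : W) : L (iterDiff f hs x) = iterDiff (fun y => L (f y)) hs x := by
  induction hs generalizing f with
  | nil => rfl
  | cons h hs ih =>
    rw [iterDiff_cons, ih, iterDiff_cons]
    congr 1
    ext y
    simp [fwdDiff, map_sub]

lemma tendsto_iterDiff {ι : Type*} {l : Filter ι} {f : ι → W → E} {f₀ : W → E}
    (h : ∀ x, Tendsto (fun i => f i x) l (𝓝 (f₀ x))) (hs : List W) (x : W) :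
    Tendsto (fun i => iterDiff (f i) hs x) l (𝓝 (iterDiff f₀ hs x)) := by
  induction hs generalizing f f₀ with
  | nil => exact h x
  | cons k hs ih => exact ih fun y => (h (y + k)).sub (h y)

/-- All finite differences of `f` of order at most `n` are bounded by `C` times the product of the
norms of the increments.  For `n ≥ 1` and complete targets this says that `f` is of class
`C^{n-1}`, with a Lipschitz derivative of order `n - 1` and all derivatives bounded. -/
def DiffBound (n : ℕ) (C : ℝ) (f : W → E) : Prop :=
  ∀ hs : List W, hs.length ≤ n → ∀ x, ‖iterDiff f hs x‖ ≤ C * (hs.map norm).prod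

lemma DiffBound.mono {n m : ℕ} {C : ℝ} {f : W → E} (hf : DiffBound n C f) (h : m ≤ n) :
    DiffBound m C f := fun hs hm => hf hs (hm.trans h)

lemma DiffBound.nonneg {n : ℕ} {C : ℝ} {f : W → E} (hf : DiffBound n C f) : 0 ≤ C := by
  simpa using (norm_nonneg _).trans (hf [] (by simp) 0)

lemma DiffBound.norm_sub_le {n : ℕ} {C : ℝ} {f : W → E} (hf : DiffBound (n + 1) C f) (x y : W) :
    ‖f x - f y‖ ≤ C * ‖x - y‖ := by
  simpa [fwdDiff] using hf [x - y] (by simp) y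

variable [NormedSpace ℝ W] [NormedSpace ℝ E]

/-- The difference quotient of `f` with step `2⁻ⁿ`. -/
def dyadicQuotient (f : W → E) (n : ℕ) (x h : W) : E :=
  (2 : ℝ) ^ n • fwdDiff (((2 : ℝ) ^ n)⁻¹ • h) f x

lemma norm_dyadicQuotient_sub_succ_le {C : ℝ} {f : W → E}
    (hf : ∀ x h : W, ‖iterDiff f [h, h] x‖ ≤ C * ‖h‖ ^ 2) (n : ℕ) (x h : W) :
    dist (dyadicQuotient f n x h) (dyadicQuotient f (n + 1) x h) ≤ C * ‖h‖ ^ 2 / 2 / 2 ^ n := by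
  set k : W := ((2 : ℝ) ^ (n + 1))⁻¹ • h with hk
  have h2 : ((2 : ℝ) ^ n)⁻¹ • h = k + k := by
    rw [hk, ← add_smul]; congr 1; field_simp; ring
  have key : dyadicQuotient f n x h - dyadicQuotient f (n + 1) x h
      = (2 : ℝ) ^ n • iterDiff f [k, k] x := by
    simp only [dyadicQuotient, h2, iterDiff_cons, iterDiff_nil, fwdDiff, pow_succ,
      mul_smul, ← smul_sub, ← add_assoc]
    congr 1
    rw [two_smul]; abel
  have hC : ‖k‖ = ((2 : ℝ) ^ (n + 1))⁻¹ * ‖h‖ := by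
    rw [hk, norm_smul, norm_inv, norm_pow, Real.norm_ofNat]
  rw [dist_eq_norm, key, norm_smul, norm_pow, Real.norm_ofNat]
  have hC0 : 0 ≤ C * ‖h‖ ^ 2 := (norm_nonneg _).trans (hf x h)
  calc (2 : ℝ) ^ n * ‖iterDiff f [k, k] x‖ ≤ 2 ^ n * (C * ‖k‖ ^ 2) := by gcongr; exact hf x k
    _ = C * ‖h‖ ^ 2 / 2 ^ n / 4 := by rw [hC]; field_simp; ring
    _ ≤ C * ‖h‖ ^ 2 / 2 / 2 ^ n := by
      rw [div_div, div_div, mul_comm ((2 : ℝ) ^ n) 4]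
      exact div_le_div_of_nonneg_left hC0 (by positivity) (by gcongr; norm_num)

/-- A map with first differences bounded by `C ‖h‖` and second differences bounded by `C ‖h‖ ‖k‖`
is differentiable.  The derivative is the limit of the difference quotients with dyadic steps. -/
lemma exists_derivative_of_diffBound [CompleteSpace E] {C : ℝ} {f : W → E}
    (hf : DiffBound 2 C f) :
    ∃ f' : W → W →L[ℝ] E,
      (∀ x h, Tendsto (fun n => dyadicQuotient f n x h) atTop (𝓝 (f' x h))) ∧
      ∀ x, HasFDerivAt f (f' x) x := by
  have hf2 : ∀ x h : W, ‖iterDiff f [h, h] x‖ ≤ C * ‖h‖ ^ 2 := fun x h => by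
    simpa [sq] using hf [h, h] le_rfl x
  have hC := hf.nonneg
  have hlim : ∀ x h, ∃ y, Tendsto (fun n => dyadicQuotient f n x h) atTop (𝓝 y) := fun x h =>
    cauchySeq_tendsto_of_complete
      (cauchySeq_of_le_geometric_two fun n => norm_dyadicQuotient_sub_succ_le hf2 n x h)
  choose D hD using hlim
  have hDbound : ∀ x h, ‖D x h‖ ≤ C * ‖h‖ := fun x h => by
    refine le_of_tendsto (hD x h).norm (Eventually.of_forall fun n => ?_)
    have := hf [((2 : ℝ) ^ n)⁻¹ • h] (by simp) x
    simp only [iterDiff_cons, iterDiff_nil, List.map_cons, List.map_nil, List.prod_cons,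
      List.prod_nil, mul_one, norm_smul, norm_inv, norm_pow, Real.norm_ofNat] at this
    rw [dyadicQuotient, norm_smul, norm_pow, Real.norm_ofNat]
    calc (2 : ℝ) ^ n * ‖fwdDiff (((2 : ℝ) ^ n)⁻¹ • h) f x‖
        ≤ 2 ^ n * (C * (((2 : ℝ) ^ n)⁻¹ * ‖h‖)) := by gcongr
      _ = C * ‖h‖ := by field_simp
  -- additivity: the defect is a second difference with steps `2⁻ⁿ h` and `2⁻ⁿ k`
  have hDadd : ∀ x h k, D x (h + k) = D x h + D x k := fun x h k => by
    have h0 : Tendsto (fun n => dyadicQuotient f n x (h + k) -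
        (dyadicQuotient f n x h + dyadicQuotient f n x k)) atTop (𝓝 0) := by
      have hg : Tendsto (fun n : ℕ => C * ‖h‖ * ‖k‖ * ((1 : ℝ) / 2) ^ n) atTop (𝓝 0) := by
        simpa using (tendsto_pow_atTop_nhds_zero_of_lt_one (r := (1 : ℝ) / 2) (by norm_num)
          (by norm_num)).const_mul (C * ‖h‖ * ‖k‖)
      refine squeeze_zero_norm (fun n => ?_) hg
      set c : ℝ := ((2 : ℝ) ^ n)⁻¹ with hc
      have hc0 : ‖c‖ = c := by rw [Real.norm_of_nonneg]; positivity
      have key : dyadicQuotient f n x (h + k) -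
          (dyadicQuotient f n x h + dyadicQuotient f n x k)
            = (2 : ℝ) ^ n • iterDiff f [c • h, c • k] x := by
        simp only [dyadicQuotient, ← hc, iterDiff_cons, iterDiff_nil, fwdDiff]
        rw [← smul_add, ← smul_sub, smul_add, add_comm (c • h) (c • k), ← add_assoc]
        congr 1; abel
      rw [key, norm_smul, norm_pow, Real.norm_ofNat]
      have := hf [c • h, c • k] (by simp) x
      simp only [List.map_cons, List.map_nil, List.prod_cons, List.prod_nil, mul_one, norm_smul,
        hc0] at this
      calc (2 : ℝ) ^ n * ‖iterDiff f [c • h, c • k] x‖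
          ≤ 2 ^ n * (C * (c * ‖h‖ * (c * ‖k‖))) := by gcongr
        _ = C * ‖h‖ * ‖k‖ * ((1 : ℝ) / 2) ^ n := by
          rw [hc, one_div, inv_pow]; field_simp
    have := tendsto_nhds_unique h0 ((hD x (h + k)).sub ((hD x h).add (hD x k)))
    exact (sub_eq_zero.1 this.symm)
  let L : W → W →L[ℝ] E := fun x =>
    (AddMonoidHom.mk' (D x) (hDadd x)).toRealLinearMap
      (AddMonoidHomClass.continuous_of_bound (AddMonoidHom.mk' (D x) (hDadd x)) C (hDbound x))
  refine ⟨L, hD, fun x => ?_⟩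
  rw [hasFDerivAt_iff_isLittleO_nhds_zero]
  have hO : (fun h => f (x + h) - f x - L x h) =O[𝓝 0] fun h => ‖h‖ ^ 2 := by
    refine Asymptotics.IsBigO.of_bound C (Eventually.of_forall fun h => ?_)
    have := dist_le_of_le_geometric_two_of_tendsto₀ (a := D x h)
      (fun n => norm_dyadicQuotient_sub_succ_le hf2 n x h) (hD x h)
    rw [dist_eq_norm] at this
    have hL : L x h = D x h := rfl
    simpa [dyadicQuotient, fwdDiff, hL] using this
  exact hO.trans_isLittleO (by simpa using Asymptotics.isLittleO_norm_pow_id (E' := W) one_lt_two)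

/-- The derivative of `f` has differences of order `n` bounded if those of `f` of order `n + 1`
are. -/
lemma DiffBound.exists_hasFDerivAt [CompleteSpace E] {n : ℕ} {C : ℝ} {f : W → E}
    (hf : DiffBound (n + 2) C f) :
    ∃ f' : W → W →L[ℝ] E, DiffBound (n + 1) C f' ∧ ∀ x, HasFDerivAt f (f' x) x := by
  obtain ⟨f', hlim, hderiv⟩ := exists_derivative_of_diffBound (hf.mono (by omega))
  refine ⟨f', fun hs hn x => ?_, hderiv⟩
  have hC := hf.nonneg
  have hprod : 0 ≤ (hs.map norm).prod := List.prod_nonneg (by simp)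
  refine ContinuousLinearMap.opNorm_le_bound _ (by positivity) fun h => ?_
  have h1 : iterDiff f' hs x h = iterDiff (fun y => f' y h) hs x :=
    map_iterDiff (ContinuousLinearMap.apply ℝ E h) f' hs x
  rw [h1]
  refine le_of_tendsto (tendsto_iterDiff (fun y => hlim y h) hs x).norm
    (Eventually.of_forall fun m => ?_)
  have h2 : iterDiff (fun y => dyadicQuotient f m y h) hs x
      = (2 : ℝ) ^ m • iterDiff f ((((2 : ℝ) ^ m)⁻¹ • h) :: hs) x := by
    exact (map_iterDiff (DistribSMul.toAddMonoidHom E ((2 : ℝ) ^ m)) _ hs x).symm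
  rw [h2, norm_smul, norm_pow, Real.norm_ofNat]
  have h3 := hf ((((2 : ℝ) ^ m)⁻¹ • h) :: hs) (by simpa using hn) x
  simp only [List.map_cons, List.prod_cons, norm_smul, norm_inv, norm_pow, Real.norm_ofNat] at h3
  calc _ ≤ (2 : ℝ) ^ m * (C * (((2 : ℝ) ^ m)⁻¹ * ‖h‖ * (hs.map norm).prod)) := by gcongr
    _ = _ := by field_simp

lemma norm_taylor_le [CompleteSpace E] {C : ℝ} {f : W → E} (hf : DiffBound 2 C f) {f' : W →L[ℝ] E}
    {x : W} (hf' : HasFDerivAt f f' x) {c : ℝ}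
    (hc : ∀ x h : W, ‖iterDiff f [h, h] x‖ ≤ c * ‖h‖ ^ 2) (h : W) :
    ‖f (x + h) - f x - f' h‖ ≤ c * ‖h‖ ^ 2 := by
  obtain ⟨L, hlim, hL⟩ := exists_derivative_of_diffBound hf
  have := dist_le_of_le_geometric_two_of_tendsto₀ (a := L x h)
      (fun n => norm_dyadicQuotient_sub_succ_le hc n x h) (hlim x h)
  rw [dist_eq_norm, (hL x).unique hf'] at this
  simpa [dyadicQuotient, fwdDiff] using this

/-- The remainder of the first order Taylor formula. -/
def taylorRem (f : W → E) (f' : W → W →L[ℝ] E) (x h : W) : E :=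
  f (x + h) - f x - f' x h

lemma norm_taylorRem_le [CompleteSpace E] {C : ℝ} {f : W → E} (hf : DiffBound 2 C f)
    {f' : W → W →L[ℝ] E} (hf' : ∀ x, HasFDerivAt f (f' x) x) (x h : W) :
    ‖taylorRem f f' x h‖ ≤ C * ‖h‖ ^ 2 :=
  norm_taylor_le hf (hf' x) (fun x h => by simpa [sq] using hf [h, h] (by simp) x) h

/-- The increments of the Taylor remainder are of second order in the small arguments `h`, `k`.
This is what makes `x ↦ f ∘ x` differentiable for the bounded variation norm on paths; it costs
one more derivative than the bound on the remainder itself. -/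
lemma norm_taylorRem_sub_le [CompleteSpace E] {C : ℝ} {f : W → E} (hf : DiffBound 3 C f)
    {f' : W → W →L[ℝ] E} (hf' : ∀ x, HasFDerivAt f (f' x) x)
    (hlip : ∀ x y, ‖f' x - f' y‖ ≤ C * ‖x - y‖) (x y h k : W) :
    ‖taylorRem f f' x h - taylorRem f f' y k‖
      ≤ C * (‖h‖ ^ 2 * ‖x - y‖ + 2 * (‖h‖ + ‖k‖) * ‖h - k‖) := by
  have hC := hf.nonneg
  -- in the first argument: Taylor's formula for the increment of `f` along `x - y`
  have h1 : ‖taylorRem f f' x h - taylorRem f f' y h‖ ≤ C * ‖x - y‖ * ‖h‖ ^ 2 := by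
    set ρ : W → E := fwdDiff (x - y) f with hρ
    have hρ2 : DiffBound 2 (C * ‖x - y‖) ρ := fun hs hn z => by
      have := hf ((x - y) :: hs) (by simp only [List.length_cons]; omega) z
      simpa [mul_assoc] using this
    have hρ' : HasFDerivAt ρ (f' x - f' y) y := by
      have h1 : HasFDerivAt (fun z => f (z + (x - y))) (f' x) y := by
        rw [hasFDerivAt_comp_add_right]; simpa using hf' x
      exact h1.sub (hf' y)
    have := norm_taylor_le hρ2 hρ' (c := C * ‖x - y‖)
      (fun z h => by simpa [sq, mul_assoc] using hρ2 [h, h] (by simp) z) h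
    refine le_trans (le_of_eq ?_) this
    congr 1
    simp only [taylorRem, hρ, fwdDiff, sub_apply]
    rw [show y + h + (x - y) = x + h by abel, show y + (x - y) = x by abel]
    abel
  -- in the second argument: Taylor's formula for `f` at `y + k`
  have h2 : ‖taylorRem f f' y h - taylorRem f f' y k‖ ≤ C * (2 * (‖h‖ + ‖k‖) * ‖h - k‖) := by
    have e : taylorRem f f' y h - taylorRem f f' y k
        = taylorRem f f' (y + k) (h - k) + (f' (y + k) - f' y) (h - k) := by
      simp only [taylorRem, sub_apply, map_sub]
      rw [show y + k + (h - k) = y + h by abel]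
      abel
    rw [e]
    have b1 := norm_taylorRem_le (hf.mono (by omega)) hf' (y + k) (h - k)
    have b2 : ‖(f' (y + k) - f' y) (h - k)‖ ≤ C * ‖k‖ * ‖h - k‖ := by
      refine (ContinuousLinearMap.le_opNorm _ _).trans ?_
      gcongr
      simpa using hlip (y + k) y
    have b3 : ‖h - k‖ ≤ ‖h‖ + ‖k‖ := norm_sub_le h k
    calc _ ≤ C * ‖h - k‖ ^ 2 + C * ‖k‖ * ‖h - k‖ := (norm_add_le _ _).trans (add_le_add b1 b2)
      _ ≤ C * ((‖h‖ + ‖k‖) * ‖h - k‖) + C * (‖h‖ + ‖k‖) * ‖h - k‖ := by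
        rw [sq]; gcongr; linarith [norm_nonneg h]
      _ = _ := by ring
  calc _ = ‖(taylorRem f f' x h - taylorRem f f' y h)
        + (taylorRem f f' y h - taylorRem f f' y k)‖ := by congr 1; abel
    _ ≤ C * ‖x - y‖ * ‖h‖ ^ 2 + C * (2 * (‖h‖ + ‖k‖) * ‖h - k‖) :=
      (norm_add_le _ _).trans (add_le_add h1 h2)
    _ = _ := by ring

end FiniteDifferences

/-! ### Smoothness of the feature map -/

section FeatureMap

variable {e : ℕ}

/-- The nested partial derivative `∂_{i₁} ⋯ ∂_{iₙ} F` of a scalar function, for the list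
`[i₁, …, iₙ]` of coordinates. -/
def nestedPartial (I : List (Fin e)) (F : V e → ℝ) : V e → ℝ :=
  I.foldr (fun i f x => lineDeriv ℝ f x (EuclideanSpace.single i 1)) F

@[simp] lemma nestedPartial_nil (F : V e → ℝ) : nestedPartial [] F = F := rfl

lemma nestedPartial_cons (i : Fin e) (I : List (Fin e)) (F : V e → ℝ) (x : V e) :
    nestedPartial (i :: I) F x =
      lineDeriv ℝ (nestedPartial I F) x (EuclideanSpace.single i 1) := rfl

lemma mixedPartial_eq_nestedPartial (g : V e → V e → ℝ) (I J : List (Fin e)) (x y : V e) :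
    mixedPartial g I J x y = nestedPartial I (fun x => mixedPartial g [] J x y) x := by
  induction I generalizing x with
  | nil => rfl
  | cons i I ih =>
    rw [nestedPartial_cons, ← funext ih]
    rfl

lemma lineDeriv_fwdDiff {F : V e → ℝ} (hF : Differentiable ℝ F) (h x v : V e) :
    lineDeriv ℝ (fwdDiff h F) x v = fwdDiff h (fun x => lineDeriv ℝ F x v) x := by
  have h1 : HasFDerivAt (fun z => F (z + h)) (fderiv ℝ F (x + h)) x := by
    rw [hasFDerivAt_comp_add_right]; exact (hF _).hasFDerivAt
  have h2 : HasFDerivAt (fwdDiff h F) (fderiv ℝ F (x + h) - fderiv ℝ F x) x :=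
    h1.sub (hF x).hasFDerivAt
  rw [h2.differentiableAt.lineDeriv_eq_fderiv, h2.fderiv]
  simp only [fwdDiff, (hF _).lineDeriv_eq_fderiv, sub_apply]

lemma differentiable_fwdDiff {F : V e → ℝ} (hF : Differentiable ℝ F) (h : V e) :
    Differentiable ℝ (fwdDiff h F) :=
  (hF.comp (differentiable_id.add_const h)).sub hF

lemma nestedPartial_fwdDiff {F : V e → ℝ} {I : List (Fin e)}
    (hF : ∀ I' : List (Fin e), I'.length < I.length → Differentiable ℝ (nestedPartial I' F))
    (h : V e) : nestedPartial I (fwdDiff h F) = fwdDiff h (nestedPartial I F) := by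
  induction I with
  | nil => rfl
  | cons i I ih =>
    ext x
    rw [nestedPartial_cons, ih fun I' hI' => hF I' (by simp only [List.length_cons]; omega),
      lineDeriv_fwdDiff (hF I (by simp))]
    rfl

lemma norm_fderiv_le_of_partial_le {F : V e → ℝ} (hF : Differentiable ℝ F) {M : ℝ}
    (hM : ∀ (i : Fin e) x, |lineDeriv ℝ F x (EuclideanSpace.single i 1)| ≤ M) (x : V e)
    (hM0 : 0 ≤ M) : ‖fderiv ℝ F x‖ ≤ e * M := by
  refine ContinuousLinearMap.opNorm_le_bound _ (by positivity) fun v => ?_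
  have hv : v = ∑ i, v i • EuclideanSpace.single i (1 : ℝ) := by
    ext j
    simp [Finset.sum_apply, Pi.single_apply]
  calc ‖fderiv ℝ F x v‖ = ‖∑ i, v i * lineDeriv ℝ F x (EuclideanSpace.single i 1)‖ := by
        conv_lhs => rw [hv]
        simp only [map_sum, map_smul, smul_eq_mul, (hF x).lineDeriv_eq_fderiv]
    _ ≤ ∑ _i : Fin e, ‖v‖ * M := by
        refine (norm_sum_le _ _).trans (Finset.sum_le_sum fun i _ => ?_)
        rw [norm_mul]
        exact mul_le_mul (PiLp.norm_apply_le v i) (hM i x) (norm_nonneg _)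
          (norm_nonneg _)
    _ = e * M * ‖v‖ := by simp; ring

/-- Iterated mean value inequality: the finite differences of order `n` are bounded by the nested
partial derivatives of order `n`.  No interchange of derivatives is needed. -/
lemma abs_iterDiff_le {n : ℕ} {F : V e → ℝ} {M : ℝ} (hM0 : 0 ≤ M)
    (hF : ∀ I : List (Fin e), I.length < n → Differentiable ℝ (nestedPartial I F))
    (hM : ∀ I : List (Fin e), I.length = n → ∀ x, |nestedPartial I F x| ≤ M)
    (hs : List (V e)) (hn : hs.length = n) (x : V e) :
    |iterDiff F hs x| ≤ e ^ n * M * (hs.map norm).prod := by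
  induction hs generalizing n F M x with
  | nil =>
    obtain rfl : n = 0 := by simpa using hn.symm
    simpa using hM [] rfl x
  | cons h hs ih =>
    obtain ⟨m, rfl⟩ : ∃ m, n = m + 1 := ⟨hs.length, by simpa using hn.symm⟩
    have hcomm : ∀ I : List (Fin e), I.length ≤ m →
        nestedPartial I (fwdDiff h F) = fwdDiff h (nestedPartial I F) := fun I hI =>
      nestedPartial_fwdDiff (fun I' hI' => hF I' (by omega)) h
    rw [iterDiff_cons]
    refine (ih (n := m) (M := e * M * ‖h‖) (by positivity) (fun I hI => ?_) (fun I hI y => ?_)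
      (by simpa using hn) x).trans (le_of_eq ?_)
    · rw [hcomm I hI.le]
      exact differentiable_fwdDiff (hF I (by omega)) h
    · rw [hcomm I hI.le, fwdDiff]
      have hd := hF I (by omega)
      have := Convex.norm_image_sub_le_of_norm_fderiv_le (𝕜 := ℝ) (f := nestedPartial I F)
        (s := univ) (x := y) (y := y + h) (C := e * M) (fun z _ => hd z)
        (fun z _ => norm_fderiv_le_of_partial_le hd
          (fun i z => by rw [← nestedPartial_cons]; exact hM (i :: I) (by simp [hI]) z) z hM0)
        convex_univ (mem_univ _) (mem_univ _)
      simpa using this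
    · simp only [List.map_cons, List.prod_cons]; ring

lemma lineDeriv_iterDiff {u : V e → V e → ℝ} (hu : ∀ x, Differentiable ℝ (u x)) (hs : List (V e))
    (x v : V e) :
    Differentiable ℝ (fun y => iterDiff (fun x => u x y) hs x) ∧
    ∀ y, lineDeriv ℝ (fun y => iterDiff (fun x => u x y) hs x) y v =
      iterDiff (fun x => lineDeriv ℝ (u x) y v) hs x := by
  induction hs generalizing u with
  | nil => exact ⟨hu x, fun y => rfl⟩
  | cons h hs ih =>
    obtain ⟨h1, h2⟩ := ih (u := fun x y => u (x + h) y - u x y) fun x => (hu _).sub (hu _)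
    refine ⟨h1, fun y => (h2 y).trans ?_⟩
    rw [iterDiff_cons]
    congr 1
    ext z
    have := ((hu (z + h) y).hasFDerivAt.sub (hu z y).hasFDerivAt)
    rw [fwdDiff, (hu _ y).lineDeriv_eq_fderiv, (hu _ y).lineDeriv_eq_fderiv]
    exact (this.hasLineDerivAt v).lineDeriv

lemma nestedPartial_iterDiff {g : V e → V e → ℝ} {J : List (Fin e)}
    (hg : ∀ J' : List (Fin e), J'.length < J.length →
      ∀ x, Differentiable ℝ (fun y => mixedPartial g [] J' x y)) (hs : List (V e)) (x y : V e) :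
    nestedPartial J (fun y => iterDiff (fun x => g x y) hs x) y =
      iterDiff (fun x => mixedPartial g [] J x y) hs x := by
  induction J generalizing y with
  | nil => rfl
  | cons j J ih =>
    rw [nestedPartial_cons,
      funext fun y => ih (fun J' hJ' => hg J' (by simp only [List.length_cons]; omega)) y,
      (lineDeriv_iterDiff (hg J (by simp)) hs x _).2]
    rfl

variable {g : V e → V e → ℝ}

lemma StaticKernelAssumption.exists_bound (hg : StaticKernelAssumption g) {n m : ℕ} (hn : n ≤ 4)
    (hm : m ≤ 4) : ∃ M, 0 ≤ M ∧ ∀ I J : List (Fin e), I.length = n → J.length = m →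
      ∀ x y, |mixedPartial g I J x y| ≤ M := by
  obtain ⟨M, hM⟩ := hg.bounded n hn m hm
  refine ⟨max M 0, le_max_right _ _, ?_⟩
  rintro I J rfl rfl x y
  refine le_trans ?_ ((hM ⟨(x, y), rfl⟩).trans (le_max_left _ _))
  refine Real.le_sqrt_of_sq_le ?_
  have h1 : |mixedPartial g I J x y| ^ 2 =
      |mixedPartial g (List.ofFn I.get) (List.ofFn J.get) x y| ^ 2 := by
    rw [List.ofFn_get, List.ofFn_get]
  rw [h1]
  refine le_trans (Finset.single_le_sum (f := fun J' : Fin J.length → Fin e =>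
    |mixedPartial g (List.ofFn I.get) (List.ofFn J') x y| ^ 2) (fun _ _ => by positivity)
    (Finset.mem_univ J.get)) ?_
  exact Finset.single_le_sum (f := fun I' : Fin I.length → Fin e =>
    ∑ J' : Fin J.length → Fin e, |mixedPartial g (List.ofFn I') (List.ofFn J') x y| ^ 2)
    (fun _ _ => Finset.sum_nonneg fun _ _ => by positivity) (Finset.mem_univ I.get)

/-- The mixed finite differences of the kernel are bounded by its mixed partial derivatives: the
iterated mean value inequality is applied in the second variable, then in the first. -/
lemma StaticKernelAssumption.exists_iterDiff_le (hg : StaticKernelAssumption g) {n : ℕ}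
    (hn : n ≤ 4) : ∃ M, 0 ≤ M ∧ ∀ hs : List (V e), hs.length = n → ∀ x y,
      |iterDiff (fun y => iterDiff (fun x => g x y) hs x) hs y| ≤ M * (hs.map norm).prod ^ 2 := by
  obtain ⟨M, hM0, hM⟩ := hg.exists_bound hn hn
  refine ⟨e ^ n * (e ^ n * M), by positivity, fun hs hhs x y => ?_⟩
  have hp : 0 ≤ (hs.map norm).prod := List.prod_nonneg (by simp)
  have h1 : ∀ J : List (Fin e), J.length ≤ n → ∀ y,
      nestedPartial J (fun y => iterDiff (fun x => g x y) hs x) y =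
        iterDiff (fun x => mixedPartial g [] J x y) hs x := fun J hJ y =>
    nestedPartial_iterDiff (fun J' hJ' => hg.differentiable_y J' (by omega)) hs x y
  refine (abs_iterDiff_le (n := n) (M := e ^ n * M * (hs.map norm).prod) (by positivity)
    (fun J hJ => ?_) (fun J hJ y => ?_) hs hhs y).trans (le_of_eq (by ring))
  · rw [funext (h1 J hJ.le)]
    exact (lineDeriv_iterDiff (hg.differentiable_y J (by omega)) hs x 0).1
  · rw [h1 J hJ.le y]
    refine abs_iterDiff_le hM0 (fun I hI => ?_) (fun I hI z => ?_) hs hhs x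
    · rw [← funext fun x => mixedPartial_eq_nestedPartial g I J x y]
      exact hg.differentiable_x I J (by omega) (by omega) y
    · rw [← mixedPartial_eq_nestedPartial]
      exact hM I J hI hJ z y

variable (H : Type) [NormedAddCommGroup H] [InnerProductSpace ℝ H] [CompleteSpace H]
  [RKHS ℝ H (V e) ℝ]

/-- The feature map `x ↦ g(x, ·)` of the reproducing kernel Hilbert space. -/
def feature (x : V e) : H := RKHS.kerFun H x (1 : ℝ)

lemma inner_feature (hH : ∀ x y, RKHS.kerFun H x (1 : ℝ) y = g x y) (x y : V e) :
    inner ℝ (feature H x) (feature H y) = g x y := by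
  rw [feature, feature, RKHS.inner_kerFun, hH]
  simp

/-- The feature map has bounded differences of order at most four, because
`‖Δ_{h₁} ⋯ Δ_{hₙ} g(x, ·)‖²` is a mixed difference of order `(n, n)` of the kernel `g`. -/
theorem exists_diffBound_feature (hg : StaticKernelAssumption g)
    (hH : ∀ x y, RKHS.kerFun H x (1 : ℝ) y = g x y) :
    ∃ C, DiffBound 4 C (feature (e := e) H) := by
  have key : ∀ n : ℕ, ∃ C, 0 ≤ C ∧ (n ≤ 4 → ∀ hs : List (V e), hs.length = n → ∀ x,
      ‖iterDiff (feature H) hs x‖ ≤ C * (hs.map norm).prod) := fun n => by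
    by_cases hn : n ≤ 4
    · obtain ⟨M, hM0, hM⟩ := hg.exists_iterDiff_le hn
      refine ⟨√M, by positivity, fun _ hs hhs x => ?_⟩
      have hp : 0 ≤ (hs.map norm).prod := List.prod_nonneg (by simp)
      refine abs_le_of_sq_le_sq' ?_ (by positivity) |>.2
      rw [mul_pow, Real.sq_sqrt hM0, ← real_inner_self_eq_norm_sq]
      have h1 : ∀ y, inner ℝ (iterDiff (feature H) hs x) (feature H y) =
          iterDiff (fun x => g x y) hs x := fun y => by
        have := map_iterDiff (innerSL ℝ (feature H y)) (feature H) hs x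
        have hsymm : ∀ x, inner ℝ (feature H y) (feature H x) = g x y := fun x => by
          rw [real_inner_comm, inner_feature H hH]
        simp only [innerSL_apply_apply, hsymm] at this
        rwa [real_inner_comm]
      have h2 := map_iterDiff (innerSL ℝ (iterDiff (feature H) hs x)) (feature H) hs x
      simp only [innerSL_apply_apply, h1] at h2
      rw [h2]
      exact (le_abs_self _).trans (hM hs hhs x x)
    · exact ⟨0, le_rfl, fun h => absurd h hn⟩
  choose C hC0 hC using key
  refine ⟨∑ n ∈ Finset.range 5, C n, fun hs hn x => (hC _ hn hs rfl x).trans ?_⟩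
  have hp : 0 ≤ (hs.map norm).prod := List.prod_nonneg (by simp)
  gcongr
  exact Finset.single_le_sum (fun n _ => hC0 n) (Finset.mem_range.2 (by omega))

end FeatureMap

/-! ### Paths of bounded variation -/

section Paths

open scoped ENNReal

variable {E F F' : Type*} [NormedAddCommGroup E] [NormedAddCommGroup F] [NormedAddCommGroup F']
  {a b : ℝ}

lemma eVariationOn_le_of_norm_sub_le {X : ℝ → E} {p : ℝ → F} {s : Set ℝ} {c : ℝ} (hc : 0 ≤ c)
    (h : ∀ u ∈ s, ∀ v ∈ s, ‖X u - X v‖ ≤ c * ‖p u - p v‖) :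
    eVariationOn X s ≤ ENNReal.ofReal c * eVariationOn p s := by
  refine iSup_le fun q => ?_
  refine le_trans ?_ (mul_le_mul_right (eVariationOn.sum_le q.2.2.1 (n := q.1) q.2.2.2) _)
  rw [Finset.mul_sum]
  refine Finset.sum_le_sum fun i _ => ?_
  rw [edist_dist, edist_dist, dist_eq_norm, dist_eq_norm, ← ENNReal.ofReal_mul hc]
  exact ENNReal.ofReal_le_ofReal (h _ (q.2.2.2 _) _ (q.2.2.2 _))

lemma IsBVPath.of_norm_sub_le {X : ℝ → E} {p : ℝ → F} (hp : IsBVPath a b p) {c : ℝ} (hc : 0 ≤ c)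
    (h : ∀ u ∈ Icc a b, ∀ v ∈ Icc a b, ‖X u - X v‖ ≤ c * ‖p u - p v‖) : IsBVPath a b X := by
  refine ⟨fun u hu => ?_, ?_⟩
  · refine tendsto_iff_norm_sub_tendsto_zero.2 ?_
    have h0 := (tendsto_iff_norm_sub_tendsto_zero.1 (hp.1 u hu)).const_mul c
    rw [mul_zero] at h0
    refine squeeze_zero' (Filter.Eventually.of_forall fun _ => norm_nonneg _) ?_ h0
    filter_upwards [self_mem_nhdsWithin] with v hv using h v hv u hu
  · refine ne_top_of_le_ne_top ?_ (eVariationOn_le_of_norm_sub_le hc h)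
    exact ENNReal.mul_ne_top ENNReal.ofReal_ne_top hp.2

lemma IsBVPath.prodMk {p : ℝ → F} {q : ℝ → F'} (hp : IsBVPath a b p) (hq : IsBVPath a b q) :
    IsBVPath a b (fun u => (p u, q u)) := by
  refine ⟨hp.1.prodMk hq.1, ?_⟩
  have : eVariationOn (fun u => (p u, q u)) (Icc a b) ≤
      eVariationOn p (Icc a b) + eVariationOn q (Icc a b) := by
    refine iSup_le fun r => ?_
    refine le_trans ?_ (add_le_add (eVariationOn.sum_le r.2.2.1 (n := r.1) r.2.2.2)
      (eVariationOn.sum_le r.2.2.1 (n := r.1) r.2.2.2))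
    rw [← Finset.sum_add_distrib]
    refine Finset.sum_le_sum fun i _ => ?_
    rw [Prod.edist_eq]
    exact max_le (le_self_add) (le_add_self)
  exact ne_top_of_le_ne_top (ENNReal.add_ne_top.2 ⟨hp.2, hq.2⟩) this

lemma IsBVPath.exists_norm_le {p : ℝ → F} (hp : IsBVPath a b p) :
    ∃ M, 0 ≤ M ∧ ∀ u ∈ Icc a b, ‖p u‖ ≤ M := by
  obtain ⟨M, hM⟩ := isCompact_Icc.exists_bound_of_continuousOn hp.1
  exact ⟨max M 0, le_max_right _ _, fun u hu => (hM u hu).trans (le_max_left _ _)⟩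

lemma IsBVPath.sub {X Y : ℝ → E} (hX : IsBVPath a b X) (hY : IsBVPath a b Y) :
    IsBVPath a b (X - Y) := by
  refine (hX.prodMk hY).of_norm_sub_le (c := 2) (by norm_num) fun u _ v _ => ?_
  have h1 : ‖X u - X v‖ ≤ ‖(X u, Y u) - (X v, Y v)‖ := norm_fst_le ((X u, Y u) - (X v, Y v))
  have h2 : ‖Y u - Y v‖ ≤ ‖(X u, Y u) - (X v, Y v)‖ := norm_snd_le ((X u, Y u) - (X v, Y v))
  calc ‖(X - Y) u - (X - Y) v‖ = ‖(X u - X v) - (Y u - Y v)‖ := by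
        simp only [Pi.sub_apply]; congr 1; abel
    _ ≤ _ := (norm_sub_le _ _).trans (by linarith)

lemma IsBVPath.const_smul [NormedSpace ℝ E] {X : ℝ → E} (hX : IsBVPath a b X) (c : ℝ) :
    IsBVPath a b (c • X) := by
  refine hX.of_norm_sub_le (c := ‖c‖) (norm_nonneg _) fun u _ v _ => ?_
  rw [Pi.smul_apply, Pi.smul_apply, ← smul_sub, norm_smul]

lemma IsBVPath.add_smul [NormedSpace ℝ E] {X Y : ℝ → E} (hX : IsBVPath a b X)
    (hY : IsBVPath a b Y) (c : ℝ) : IsBVPath a b (X + c • Y) := by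
  simpa [sub_eq_add_neg] using hX.sub (hY.const_smul (-c))

end Paths

/-! ### The Stieltjes measure of a continuous path of bounded variation -/

section Stieltjes

open scoped ENNReal Topology
open Filter

variable {E : Type*} [NormedAddCommGroup E]

lemma borel_real_eq_generateFrom_Ioc : (inferInstance : MeasurableSpace ℝ) =
    MeasurableSpace.generateFrom {s | ∃ u v : ℝ, u ≤ v ∧ s = Ioc u v} := by
  refine (BorelSpace.measurable_eq (α := ℝ)).trans ((borel_eq_generateFrom_Ioc_le ℝ).trans ?_)
  congr 1
  ext s
  simp only [mem_ofPred_eq]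
  exact ⟨fun ⟨u, v, h, h'⟩ => ⟨u, v, h, h'.symm⟩, fun ⟨u, v, h, h'⟩ => ⟨u, v, h, h'.symm⟩⟩

lemma iUnion_Ioc_neg_nat : ⋃ n : ℕ, Ioc (-(n : ℝ)) n = univ := by
  refine eq_univ_of_forall fun x => mem_iUnion.2 ?_
  obtain ⟨n, hn⟩ := exists_nat_gt |x|
  exact ⟨n, by linarith [neg_abs_le x], (le_abs_self x).trans hn.le⟩

lemma monotone_Ioc_neg_nat : Monotone fun n : ℕ => Ioc (-(n : ℝ)) n := fun n m hnm =>
  Ioc_subset_Ioc (by simpa using hnm) (by simpa using hnm)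

lemma VectorMeasure.ext_of_Ioc {μ ν : VectorMeasure ℝ E}
    (h : ∀ u v : ℝ, u ≤ v → μ (Ioc u v) = ν (Ioc u v)) : μ = ν := by
  refine VectorMeasure.ext_of_generateFrom {s | ∃ u v : ℝ, u ≤ v ∧ s = Ioc u v} ?_ ?_
    ?_ ?_
  · rintro _ ⟨u, v, huv, rfl⟩
    exact h u v huv
  · exact borel_real_eq_generateFrom_Ioc
  · rintro _ ⟨u, v, _, rfl⟩ _ ⟨u', v', _, rfl⟩ hne
    rw [Ioc_inter_Ioc] at hne ⊢
    exact ⟨_, _, (nonempty_Ioc.1 hne).le, rfl⟩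
  · have h1 := μ.tendsto_vectorMeasure_iUnion_atTop_nat monotone_Ioc_neg_nat
      fun n => measurableSet_Ioc
    have h2 := ν.tendsto_vectorMeasure_iUnion_atTop_nat monotone_Ioc_neg_nat
      fun n => measurableSet_Ioc
    rw [iUnion_Ioc_neg_nat] at h1 h2
    refine tendsto_nhds_unique h1 (h2.congr fun n => (h _ _ ?_).symm)
    have : (0 : ℝ) ≤ n := n.cast_nonneg
    linarith

/-- A finite measure that dominates a vector measure on half-open intervals dominates its variation. -/
lemma VectorMeasure.variation_le_of_Ioc [CompleteSpace E] {μ : VectorMeasure ℝ E} {m : Measure ℝ}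
    [IsFiniteMeasure m] (h : ∀ u v : ℝ, u ≤ v → ‖μ (Ioc u v)‖ₑ ≤ m (Ioc u v)) :
    μ.variation ≤ m := by
  have hIoc : ∀ u v : ℝ, u ≤ v → AddContent.onIoc (fun x => μ (Iic x)) (Ioc u v) = μ (Ioc u v) :=
    fun u v huv => by
      rw [AddContent.onIoc_apply huv, ← Iic_union_Ioc_eq_Iic huv,
        VectorMeasure.of_union (by simp) measurableSet_Iic measurableSet_Ioc]
      abel
  obtain ⟨m', hm', hle⟩ :=
    VectorMeasure.exists_extension_of_isSetSemiring_of_le_measure_of_generateFrom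
      (m := AddContent.onIoc (fun x => μ (Iic x))) (μ := m) IsSetSemiring.Ioc
      (by rintro _ ⟨u, v, huv, rfl⟩; rw [hIoc u v huv]; exact h u v huv)
      borel_real_eq_generateFrom_Ioc
  have : m' = μ := VectorMeasure.ext_of_Ioc fun u v huv => by
    rw [hm' _ ⟨u, v, huv, rfl⟩, hIoc u v huv]
  subst this
  exact VectorMeasure.variation_le_of_forall_enorm_le fun s _ => hle s

variable {a b : ℝ}

lemma clamp_mem (hab : a ≤ b) (u : ℝ) : max a (min u b) ∈ Icc a b :=
  ⟨le_max_left _ _, max_le hab (min_le_right _ _)⟩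

lemma eVariationOn_clamp_le (hab : a ≤ b) (X : ℝ → E) (s : Set ℝ) :
    eVariationOn (clamp a b X) s ≤ eVariationOn X (Icc a b) :=
  eVariationOn.comp_le_of_monotoneOn X (fun u => max a (min u b))
    (fun _ _ _ _ huv => max_le_max le_rfl (min_le_min huv le_rfl)) fun u _ => clamp_mem hab u

lemma IsBVPath.boundedVariationOn_clamp {X : ℝ → E} (hX : IsBVPath a b X) (hab : a ≤ b) :
    BoundedVariationOn (clamp a b X) univ :=
  ne_top_of_le_ne_top hX.2 (eVariationOn_clamp_le hab X univ)

lemma IsBVPath.continuous_clamp {X : ℝ → E} (hX : IsBVPath a b X) (hab : a ≤ b) :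
    Continuous (clamp a b X) :=
  hX.1.comp_continuous (by fun_prop) fun u => clamp_mem hab u

variable [CompleteSpace E]

lemma dPath_eq_vectorMeasure {X : ℝ → E} (h : BoundedVariationOn (clamp a b X) univ) :
    dPath a b X = h.vectorMeasure := by
  rw [dPath, dif_pos h]

lemma IsBVPath.dPath_Ioc {X : ℝ → E} (hX : IsBVPath a b X) (hab : a ≤ b) {u v : ℝ} (huv : u ≤ v) :
    dPath a b X (Ioc u v) = clamp a b X v - clamp a b X u := by
  have hc := hX.continuous_clamp hab
  rw [dPath_eq_vectorMeasure (hX.boundedVariationOn_clamp hab),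
    BoundedVariationOn.vectorMeasure_Ioc _ huv, hc.continuousWithinAt.rightLim_eq,
    hc.continuousWithinAt.rightLim_eq]

lemma dPath_add_smul [NormedSpace ℝ E] (hab : a ≤ b) {X Y Z : ℝ → E} (hX : IsBVPath a b X)
    (hY : IsBVPath a b Y) (c : ℝ) (hZ : EqOn Z (X + c • Y) (Icc a b)) :
    dPath a b Z = dPath a b X + c • dPath a b Y := by
  have hcl : clamp a b Z = clamp a b (X + c • Y) := funext fun u => hZ (clamp_mem hab u)
  have hZ' : dPath a b Z = dPath a b (X + c • Y) := by unfold dPath; rw! [hcl]; rfl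
  rw [hZ']
  refine VectorMeasure.ext_of_Ioc fun u v huv => ?_
  rw [add_apply, smul_apply, (hX.add_smul hY c).dPath_Ioc hab huv,
    hX.dPath_Ioc hab huv, hY.dPath_Ioc hab huv]
  simp only [clamp, Pi.add_apply, Pi.smul_apply, smul_sub]
  abel

/-- The total variation of the Stieltjes measure is at most the variation of the path, because the
measure with distribution function `x ↦ Var(X; [a, x])` dominates it on intervals. -/
lemma IsBVPath.variation_dPath_le {X : ℝ → E} (hX : IsBVPath a b X) (hab : a ≤ b) :
    (dPath a b X).variation univ ≤ eVariationOn X (Icc a b) := by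
  set f := clamp a b X with hf
  have hbv := hX.boundedVariationOn_clamp hab
  have hr : f.rightLim = f :=
    funext fun x => (hX.continuous_clamp hab).continuousWithinAt.rightLim_eq
  set S := hbv.stieltjesFunctionRightLim a with hS
  have hSx : ∀ x, S x = variationOnFromTo f univ a x := fun x => by
    rw [hS, BoundedVariationOn.stieltjesFunctionRightLim_apply]
    change variationOnFromTo f.rightLim univ a x = _
    rw [hr]
  have : IsFiniteMeasure S.measure := S.isFiniteMeasure_of_forall_abs_le fun x => by
    rw [hSx]; exact variationOnFromTo.abs_le_eVariationOn hbv
  have hIoc : ∀ u v : ℝ, u ≤ v → S.measure (Ioc u v) = eVariationOn f (Icc u v) := fun u v huv => by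
    rw [StieltjesFunction.measure_Ioc, hSx, hSx,
      ← variationOnFromTo.add hbv.locallyBoundedVariationOn (mem_univ a) (mem_univ u) (mem_univ v),
      add_sub_cancel_left, variationOnFromTo.eq_of_le _ _ huv, univ_inter,
      ENNReal.ofReal_toReal (hbv.mono (subset_univ _))]
  have hle : (dPath a b X).variation ≤ S.measure :=
    VectorMeasure.variation_le_of_Ioc fun u v huv => by
      rw [hX.dPath_Ioc hab huv, hIoc u v huv, ← edist_eq_enorm_sub]
      exact eVariationOn.edist_le _ ⟨huv, le_rfl⟩ ⟨le_rfl, huv⟩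
  refine (hle univ).trans ?_
  rw [← iUnion_Ioc_neg_nat, monotone_Ioc_neg_nat.measure_iUnion]
  refine iSup_le fun n => ?_
  have : (0 : ℝ) ≤ n := n.cast_nonneg
  rw [hIoc _ _ (by linarith)]
  exact eVariationOn_clamp_le hab X _

lemma IsBVPath.isFiniteMeasure {X : ℝ → E} (hX : IsBVPath a b X) (hab : a ≤ b) :
    IsFiniteMeasure (dPath a b X).variation :=
  ⟨(hX.variation_dPath_le hab).trans_lt (lt_top_iff_ne_top.2 hX.2)⟩

lemma IsBVPath.noAtoms {X : ℝ → E} (hX : IsBVPath a b X) (hab : a ≤ b) :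
    NullSingletonClass (dPath a b X).variation := by
  refine ⟨fun x => ?_⟩
  rw [VectorMeasure.variation_apply_eq_zero (measurableSet_singleton x)]
  intro s hs _
  have hc := (hX.continuous_clamp hab).continuousAt (x := x)
  rcases subset_singleton_iff_eq.1 hs with rfl | rfl
  · simp
  · rw [dPath_eq_vectorMeasure (hX.boundedVariationOn_clamp hab),
      BoundedVariationOn.vectorMeasure_singleton, hc.continuousWithinAt.rightLim_eq,
      hc.continuousWithinAt.leftLim_eq, sub_self]

end Stieltjes

/-! ### Powers of the distribution function of an atomless measure -/

section Powers

variable (m : Measure ℝ) [IsFiniteMeasure m] [NullSingletonClass m]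

lemma continuousOn_measureReal_Ioc (a r : ℝ) :
    ContinuousOn (fun u => m.real (Ioc a u)) (Icc a r) := by
  have h := intervalIntegral.continuous_primitive (μ := m) (f := fun _ => (1 : ℝ))
    (fun a b => intervalIntegrable_const) a
  refine h.continuousOn.congr fun u hu => ?_
  simp [intervalIntegral.integral_of_le hu.1]

omit [NullSingletonClass m] in
lemma monotone_measureReal_Ioc (a : ℝ) : Monotone fun u => m.real (Ioc a u) :=
  fun _ _ huv => measureReal_mono (Ioc_subset_Ioc_right huv)

/-- The image of an atomless measure under its distribution function is Lebesgue measure. -/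
lemma map_measureReal_Ioc {a r : ℝ} (har : a ≤ r) :
    (m.restrict (Ioc a r)).map (fun u => m.real (Ioc a u)) =
      volume.restrict (Ioc 0 (m.real (Ioc a r))) := by
  set w : ℝ → ℝ := fun u => m.real (Ioc a u) with hw
  have hmono : Monotone w := monotone_measureReal_Ioc m a
  have hwa : w a = 0 := by simp [hw]
  refine Measure.ext_of_Iic _ _ fun x => ?_
  rw [Measure.map_apply hmono.measurable measurableSet_Iic,
    Measure.restrict_apply (hmono.measurable measurableSet_Iic),
    Measure.restrict_apply measurableSet_Iic, inter_comm (Iic x), Ioc_inter_Iic, Real.volume_Ioc,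
    sub_zero]
  rcases lt_or_ge x 0 with hx | hx
  · have : w ⁻¹' Iic x ∩ Ioc a r = ∅ := by
      refine eq_empty_of_forall_notMem fun u hu => ?_
      have h1 : w u ≤ x := hu.1
      exact absurd (measureReal_nonneg (μ := m) (s := Ioc a u)) (not_le.2 (h1.trans_lt hx))
    rw [this, measure_empty, ENNReal.ofReal_of_nonpos ((min_le_right _ _).trans hx.le)]
  · -- `c` is the largest point of `[a, r]` with `w c ≤ x`; by continuity `w c = min (w r) x`
    have hcont : ContinuousOn w (Icc a r) := continuousOn_measureReal_Ioc m a r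
    have hcomp : IsCompact (Icc a r ∩ w ⁻¹' Iic x) :=
      isCompact_Icc.of_isClosed_subset (hcont.preimage_isClosed_of_isClosed isClosed_Icc isClosed_Iic)
        inter_subset_left
    obtain ⟨c, ⟨hc, hcx⟩, hcmax⟩ := hcomp.exists_isGreatest
      ⟨a, ⟨le_rfl, har⟩, by simpa [hwa] using hx⟩
    have hset : w ⁻¹' Iic x ∩ Ioc a r = Ioc a c := by
      ext u
      constructor
      · rintro ⟨h1, h2, h3⟩
        exact ⟨h2, hcmax ⟨⟨h2.le, h3⟩, h1⟩⟩
      · rintro ⟨h1, h2⟩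
        exact ⟨(hmono h2).trans hcx, h1, h2.trans hc.2⟩
    have hwc : w c = min (w r) x := by
      refine le_antisymm (le_min (hmono hc.2) hcx) ?_
      obtain ⟨d, hd, hdx⟩ := intermediate_value_Icc har hcont
        (show min (w r) x ∈ Icc (w a) (w r) from
          ⟨le_min (hmono har) (by rwa [hwa]), min_le_left _ _⟩)
      rw [← hdx]
      exact hmono (hcmax ⟨hd, by
        rw [mem_preimage, hdx]; exact mem_Iic.2 (min_le_right (w r) x)⟩)
    rw [hset, ← hwc, hw, ofReal_measureReal]

lemma setIntegral_measureReal_Ioc_pow {a r : ℝ} (har : a ≤ r) (n : ℕ) :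
    ∫ u in Ioc a r, m.real (Ioc a u) ^ n ∂m = m.real (Ioc a r) ^ (n + 1) / (n + 1) := by
  have h1 : ∫ u in Ioc a r, m.real (Ioc a u) ^ n ∂m =
      ∫ x, x ^ n ∂((m.restrict (Ioc a r)).map fun u => m.real (Ioc a u)) := by
    rw [integral_map (monotone_measureReal_Ioc m a).measurable.aemeasurable
      (by fun_prop)]
  rw [h1, map_measureReal_Ioc m har, ← intervalIntegral.integral_of_le measureReal_nonneg,
    integral_pow]
  simp

omit [NullSingletonClass m] in
lemma integrableOn_measureReal_Ioc_pow (a r : ℝ) (n : ℕ) :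
    IntegrableOn (fun u => m.real (Ioc a u) ^ n) (Ioc a r) m := by
  refine Integrable.of_bound (C := m.real univ ^ n)
    ((monotone_measureReal_Ioc m a).measurable.pow_const n).aestronglyMeasurable
    (Filter.Eventually.of_forall fun u => ?_)
  rw [norm_pow, Real.norm_of_nonneg measureReal_nonneg]
  exact pow_le_pow_left₀ measureReal_nonneg (measureReal_mono (subset_univ _)) n

end Powers

/-! ### Integrals with a variable upper limit -/

section Primitive

open Filter Topology

variable {E F G : Type*} [NormedAddCommGroup E] [NormedSpace ℝ E] [NormedAddCommGroup F]
  [NormedSpace ℝ F] [NormedAddCommGroup G] [NormedSpace ℝ G]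

lemma continuous_setIntegral_Ioc {P : Type*} [TopologicalSpace P] [FirstCountableTopology P]
    {μ : VectorMeasure ℝ F} [IsFiniteMeasure μ.variation] [NullSingletonClass μ.variation]
    (B : E →L[ℝ] F →L[ℝ] G) (a : ℝ) {ρ : P → ℝ} (hρ : Continuous ρ) {f : P → ℝ → E}
    (hmeas : ∀ p, StronglyMeasurable (f p)) {C : ℝ} (hC : ∀ p u, ‖f p u‖ ≤ C)
    (hcont : ∀ u, Continuous fun p => f p u) :
    Continuous fun p => (μ.restrict (Ioc a (ρ p))).integral (f p) B := by
  simp only [← VectorMeasure.integral_indicator measurableSet_Ioc]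
  refine continuous_iff_continuousAt.2 fun p₀ => ?_
  refine VectorMeasure.continuousAt_of_dominated (bound := fun _ => C)
    (Eventually.of_forall fun p => ((hmeas p).indicator measurableSet_Ioc).aestronglyMeasurable)
    (Eventually.of_forall fun p => Eventually.of_forall fun u =>
      (norm_indicator_le_norm_self _ _).trans (hC p u)) (integrable_const _) ?_
  -- the integrand is continuous at `p₀` except at the single point `u = ρ p₀`
  have hne : ∀ᵐ u ∂μ.variation, u ≠ ρ p₀ := by
    rw [ae_iff]; simp
  filter_upwards [hne] with u hu
  rcases lt_or_gt_of_ne hu with hu | hu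
  · have hev : ∀ᶠ p in 𝓝 p₀, u < ρ p := hρ.continuousAt.eventually_const_lt hu
    refine ContinuousAt.congr (f := fun p => (Ioi a).indicator (f p) u) ?_ ?_
    · by_cases h : u ∈ Ioi a
      · simpa only [indicator_of_mem h] using (hcont u).continuousAt
      · simpa only [indicator_of_notMem h] using continuousAt_const
    · filter_upwards [hev] with p hp
      by_cases h : u ∈ Ioi a
      · rw [indicator_of_mem h, indicator_of_mem (show u ∈ Ioc a (ρ p) from ⟨h, hp.le⟩)]
      · rw [indicator_of_notMem h, indicator_of_notMem fun h' => h h'.1]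
  · have hev : ∀ᶠ p in 𝓝 p₀, ρ p < u := hρ.continuousAt.eventually_lt_const hu
    refine ContinuousAt.congr (f := fun _ => (0 : E)) continuousAt_const ?_
    filter_upwards [hev] with p hp
    rw [indicator_of_notMem fun h' => absurd h'.2 (not_le.2 hp)]

lemma norm_setIntegral_le_setIntegral {μ : VectorMeasure ℝ F} {B : E →L[ℝ] F →L[ℝ] G}
    (hB : ‖B‖ ≤ 1) {f : ℝ → E} {w : ℝ → ℝ} {S : Set ℝ} (hS : MeasurableSet S)
    (hw : IntegrableOn w S μ.variation) (h : ∀ u ∈ S, ‖f u‖ ≤ w u) :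
    ‖(μ.restrict S).integral f B‖ ≤ ∫ u in S, w u ∂μ.variation := by
  refine (VectorMeasure.norm_integral_le_integral_norm).trans ?_
  rw [VectorMeasure.variation_restrict hS]
  refine (mul_le_of_le_one_left (integral_nonneg fun _ => norm_nonneg _) hB).trans ?_
  refine integral_mono_of_nonneg (Eventually.of_forall fun _ => norm_nonneg _) hw ?_
  filter_upwards [ae_restrict_mem hS] with u hu using h u hu

lemma integral_fun_add_smul {μ : VectorMeasure ℝ F} {B : E →L[ℝ] F →L[ℝ] G} {f g : ℝ → E}
    (hf : μ.Integrable f) (hg : μ.Integrable g) (c : ℝ) :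
    μ.integral (fun u => f u + c • g u) B = μ.integral f B + c • μ.integral g B :=
  (VectorMeasure.integral_fun_add hf (hg.smul c)).trans
    (congrArg _ (VectorMeasure.integral_fun_smul μ B c g))

lemma norm_lsmul_le' : ‖(ContinuousLinearMap.lsmul ℝ ℝ : ℝ →L[ℝ] F →L[ℝ] F)‖ ≤ 1 :=
  ContinuousLinearMap.opNorm_lsmul_le

end Primitive

/-! ### Double Stieltjes integrals -/

section DoubleIntegral

variable {H : Type} [NormedAddCommGroup H] [InnerProductSpace ℝ H] [CompleteSpace H]
  {T t s : ℝ} {X Y : ℝ → H} {F : ℝ → ℝ → ℝ}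

/-- The inner integral `∫_t^r F(u, v) dX_u` of a double Stieltjes integral. -/
def innerIntegral (T t : ℝ) (F : ℝ → ℝ → ℝ) (X : ℝ → H) (r v : ℝ) : H :=
  ((dPath t T X).restrict (Ioc t r)).integral (fun u => F u v) (ContinuousLinearMap.lsmul ℝ ℝ)

lemma doubleIntegral_eq (r q : ℝ) : doubleIntegral T t s F X Y r q =
    ((dPath s T Y).restrict (Ioc s q)).integral (innerIntegral T t F X r) (innerSL ℝ) := rfl

lemma doubleIntegral_congr {F' : ℝ → ℝ → ℝ} {r q : ℝ}
    (h : ∀ u ∈ Ioc t r, ∀ v ∈ Ioc s q, F u v = F' u v) :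
    doubleIntegral T t s F X Y r q = doubleIntegral T t s F' X Y r q := by
  rw [doubleIntegral_eq, doubleIntegral_eq]
  refine VectorMeasure.setIntegral_congr_fun fun v hv => ?_
  exact VectorMeasure.setIntegral_congr_fun fun u hu => h u hu v hv

lemma abs_doubleIntegral_le (hX : IsBVPath t T X) (htT : t ≤ T) (hY : IsBVPath s T Y)
    (hsT : s ≤ T) {r q : ℝ} {w : ℝ → ℝ}
    (hw : IntegrableOn w (Ioc t r) (dPath t T X).variation)
    (h : ∀ u ∈ Ioc t r, ∀ v ∈ Ioc s q, |F u v| ≤ w u) (hw0 : ∀ u ∈ Ioc t r, 0 ≤ w u) :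
    |doubleIntegral T t s F X Y r q| ≤
      (∫ u in Ioc t r, w u ∂(dPath t T X).variation) * (dPath s T Y).variation.real univ := by
  have := hX.isFiniteMeasure htT
  have := hY.isFiniteMeasure hsT
  have h0 : 0 ≤ ∫ u in Ioc t r, w u ∂(dPath t T X).variation :=
    setIntegral_nonneg measurableSet_Ioc hw0
  rw [doubleIntegral_eq, ← Real.norm_eq_abs]
  refine (VectorMeasure.norm_setIntegral_le_of_norm_le_const (fun v hv =>
    norm_setIntegral_le_setIntegral norm_lsmul_le' measurableSet_Ioc hw
      fun u hu => h u hu v hv)).trans ?_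
  refine mul_le_mul ?_ (measureReal_mono (subset_univ _)) measureReal_nonneg h0
  exact mul_le_of_le_one_right h0 (norm_innerSL_le ℝ)

/-- A bounded continuous integrand on the plane. -/
structure IsBCIntegrand (F : ℝ → ℝ → ℝ) (C : ℝ) : Prop where
  continuous : Continuous fun p : ℝ × ℝ => F p.1 p.2
  bound : ∀ u v, |F u v| ≤ C

namespace IsBCIntegrand

variable {C : ℝ}

lemma continuous_left (hF : IsBCIntegrand F C) (v : ℝ) : Continuous fun u => F u v :=
  hF.continuous.comp (by fun_prop : Continuous fun u : ℝ => (u, v))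

lemma continuous_right (hF : IsBCIntegrand F C) (u : ℝ) : Continuous fun v => F u v :=
  hF.continuous.comp (by fun_prop : Continuous fun v : ℝ => (u, v))

lemma integrable_left (hF : IsBCIntegrand F C) (v : ℝ) (m : Measure ℝ) [IsFiniteMeasure m] :
    Integrable (fun u => F u v) m :=
  Integrable.of_bound (hF.continuous_left v).aestronglyMeasurable C
    (Filter.Eventually.of_forall fun u => hF.bound u v)

lemma norm_innerIntegral_le (hF : IsBCIntegrand F C) (hX : IsBVPath t T X) (htT : t ≤ T)
    (r v : ℝ) : ‖innerIntegral T t F X r v‖ ≤ C * (dPath t T X).variation.real univ := by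
  have := hX.isFiniteMeasure htT
  have hC : 0 ≤ C := (abs_nonneg _).trans (hF.bound 0 0)
  refine (VectorMeasure.norm_setIntegral_le_of_norm_le_const (C := C)
    fun u _ => hF.bound u v).trans ?_
  refine mul_le_mul ?_ (measureReal_mono (subset_univ _)) measureReal_nonneg hC
  exact mul_le_of_le_one_right hC norm_lsmul_le'

lemma continuous_innerIntegral (hF : IsBCIntegrand F C) (hX : IsBVPath t T X) (htT : t ≤ T) :
    Continuous fun p : ℝ × ℝ => innerIntegral T t F X p.1 p.2 := by
  have := hX.isFiniteMeasure htT
  have := hX.noAtoms htT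
  exact continuous_setIntegral_Ioc (P := ℝ × ℝ) (ContinuousLinearMap.lsmul ℝ ℝ) t continuous_fst
    (f := fun p u => F u p.2) (fun p => (hF.continuous_left p.2).stronglyMeasurable)
    (fun p u => hF.bound u p.2) fun u => (hF.continuous_right u).comp continuous_snd

lemma continuous_innerIntegral_right (hF : IsBCIntegrand F C) (hX : IsBVPath t T X) (htT : t ≤ T)
    (r : ℝ) : Continuous (innerIntegral T t F X r) := by
  have h := (hF.continuous_innerIntegral hX htT).comp (by fun_prop : Continuous fun v : ℝ => (r, v))
  simpa only [Function.comp_def] using h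

lemma integrable_innerIntegral (hF : IsBCIntegrand F C) (hX : IsBVPath t T X) (htT : t ≤ T)
    (r : ℝ) (m : Measure ℝ) [IsFiniteMeasure m] : Integrable (innerIntegral T t F X r) m :=
  Integrable.of_bound (hF.continuous_innerIntegral_right hX htT r).aestronglyMeasurable _
    (Filter.Eventually.of_forall fun v => hF.norm_innerIntegral_le hX htT r v)

lemma continuous_doubleIntegral (hF : IsBCIntegrand F C) (hX : IsBVPath t T X) (htT : t ≤ T)
    (hY : IsBVPath s T Y) (hsT : s ≤ T) :
    Continuous fun p : ℝ × ℝ => doubleIntegral T t s F X Y p.1 p.2 := by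
  have := hY.isFiniteMeasure hsT
  have := hY.noAtoms hsT
  have hc : ∀ v, Continuous fun p : ℝ × ℝ => innerIntegral T t F X p.1 v := fun v => by
    have h := (hF.continuous_innerIntegral hX htT).comp
      (by fun_prop : Continuous fun p : ℝ × ℝ => (p.1, v))
    simpa only [Function.comp_def] using h
  exact continuous_setIntegral_Ioc (P := ℝ × ℝ) (innerSL ℝ) s continuous_snd
    (f := fun p => innerIntegral T t F X p.1)
    (fun p => (hF.continuous_innerIntegral_right hX htT p.1).stronglyMeasurable)
    (fun p v => hF.norm_innerIntegral_le hX htT p.1 v) hc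

lemma doubleIntegral_add_smul {F' : ℝ → ℝ → ℝ} {C' : ℝ} (hF : IsBCIntegrand F C)
    (hF' : IsBCIntegrand F' C') (c : ℝ) (hX : IsBVPath t T X) (htT : t ≤ T)
    (hY : IsBVPath s T Y) (hsT : s ≤ T) (r q : ℝ) :
    doubleIntegral T t s (fun u v => F u v + c * F' u v) X Y r q =
      doubleIntegral T t s F X Y r q + c * doubleIntegral T t s F' X Y r q := by
  have := hX.isFiniteMeasure htT
  have := hY.isFiniteMeasure hsT
  have h1 : innerIntegral T t (fun u v => F u v + c * F' u v) X r =
      fun v => innerIntegral T t F X r v + c • innerIntegral T t F' X r v := by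
    ext v
    exact integral_fun_add_smul (hF.integrable_left v _) (hF'.integrable_left v _) c
  simp only [doubleIntegral_eq]
  rw [h1]
  exact integral_fun_add_smul (hF.integrable_innerIntegral hX htT r _)
    (hF'.integrable_innerIntegral hX htT r _) c

lemma doubleIntegral_path_add_smul {X' Z : ℝ → H} (hF : IsBCIntegrand F C) (hX : IsBVPath t T X)
    (hX' : IsBVPath t T X') (htT : t ≤ T) (hY : IsBVPath s T Y) (hsT : s ≤ T) (c : ℝ)
    (hZ : EqOn Z (X + c • X') (Icc t T)) (r q : ℝ) :
    doubleIntegral T t s F Z Y r q =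
      doubleIntegral T t s F X Y r q + c * doubleIntegral T t s F X' Y r q := by
  have := hX.isFiniteMeasure htT
  have := hX'.isFiniteMeasure htT
  have := hY.isFiniteMeasure hsT
  have h1 : innerIntegral T t F Z r =
      fun v => innerIntegral T t F X r v + c • innerIntegral T t F X' r v := by
    ext v
    have hr : (dPath t T X + c • dPath t T X').restrict (Ioc t r) =
        (dPath t T X).restrict (Ioc t r) + c • (dPath t T X').restrict (Ioc t r) := by
      rw [VectorMeasure.restrict_add, VectorMeasure.restrict_smul]
    rw [innerIntegral, innerIntegral, innerIntegral, dPath_add_smul htT hX hX' c hZ, hr,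
      VectorMeasure.integral_add_vectorMeasure (hF.integrable_left v _)
        (VectorMeasure.Integrable.smul_vectorMeasure (hF.integrable_left v _) c),
      VectorMeasure.integral_smul_vectorMeasure]
  simp only [doubleIntegral_eq]
  rw [h1]
  exact integral_fun_add_smul (hF.integrable_innerIntegral hX htT r _)
    (hF.integrable_innerIntegral hX' htT r _) c

end IsBCIntegrand

end DoubleIntegral

/-! ### First order expansions of one-parameter families -/

section Expansion

open scoped Topology

variable {E : Type*} [NormedAddCommGroup E] [NormedSpace ℝ E]

/-- A first order expansion `I ε = I₀ + ε I' + O(ε²)` near `ε = 0`. -/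
def HasExpansion (I : ℝ → E) (I₀ I' : E) : Prop :=
  ∃ C : ℝ, ∀ ε : ℝ, |ε| ≤ 1 → ‖I ε - I₀ - ε • I'‖ ≤ C * ε ^ 2

lemma HasExpansion.apply_zero {I : ℝ → E} {I₀ I' : E} (h : HasExpansion I I₀ I') : I 0 = I₀ := by
  obtain ⟨C, h⟩ := h
  have := h 0 (by simp)
  simpa [sub_eq_zero] using this

lemma HasExpansion.hasDerivAt {I : ℝ → E} {I₀ I' : E} (h : HasExpansion I I₀ I') :
    HasDerivAt I I' 0 := by
  have h0 := h.apply_zero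
  obtain ⟨C, h⟩ := h
  rw [hasDerivAt_iff_isLittleO_nhds_zero]
  have hO : (fun ε : ℝ => I (0 + ε) - I 0 - ε • I') =O[𝓝 0] fun ε => ‖ε‖ ^ 2 := by
    refine Asymptotics.IsBigO.of_bound C ?_
    filter_upwards [Metric.closedBall_mem_nhds (0 : ℝ) one_pos] with ε hε
    rw [zero_add, norm_pow, norm_norm, Real.norm_eq_abs, sq_abs, h0]
    exact h ε (by simpa using hε)
  exact hO.trans_isLittleO (by simpa using Asymptotics.isLittleO_norm_pow_id (E' := ℝ) one_lt_two)

/-- The product rule for an operator applied to a vector. -/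
lemma HasExpansion.hasDerivAt_apply {I : ℝ → E →L[ℝ] E} {I₀ I' : E →L[ℝ] E}
    (h : HasExpansion I I₀ I') {x : ℝ → E} {x₀ x' : E} (hx : HasDerivAt x x' 0) (hx₀ : x 0 = x₀) :
    HasDerivAt (fun ε => I ε (x ε)) (I' x₀ + I₀ x') 0 := by
  rw [← h.apply_zero, ← hx₀]
  exact h.hasDerivAt.clm_apply hx

end Expansion

/-! ### Neumann series -/

section Neumann

variable {E : Type*} [NormedAddCommGroup E] [NormedSpace ℝ E]

/-- The Neumann series `∑ Iⁿ`, which is the resolvent `(1 - I)⁻¹` if `∑ ‖Iⁿ‖` converges. -/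
def neumann (I : E →L[ℝ] E) : E →L[ℝ] E := ∑' n : ℕ, I ^ n

variable [CompleteSpace E]

lemma hasSum_neumann_apply {I : E →L[ℝ] E} (h : Summable fun n : ℕ => ‖I ^ n‖) (x : E) :
    HasSum (fun n => (I ^ n) x) (neumann I x) :=
  (ContinuousLinearMap.apply ℝ E x).hasSum h.of_norm.hasSum

lemma neumann_apply_eq {I : E →L[ℝ] E} (h : Summable fun n : ℕ => ‖I ^ n‖) (x : E) :
    neumann I x = I (neumann I x) + x := by
  have h : (1 - I) * neumann I = 1 := h.of_norm.one_sub_mul_tsum_pow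
  have := congrArg (fun L => L x) h
  simp only [mul_apply_eq_comp, sub_apply, one_apply_eq_self] at this
  exact sub_eq_iff_eq_add'.1 this

/-- The operator `1 - I` as a unit, with the Neumann series as its inverse. -/
def oneSubUnit (I : E →L[ℝ] E) (h : Summable fun n : ℕ => ‖I ^ n‖) : (E →L[ℝ] E)ˣ where
  val := 1 - I
  inv := neumann I
  val_inv := h.of_norm.one_sub_mul_tsum_pow
  inv_val := h.of_norm.tsum_pow_mul_one_sub

/-- The resolvent `A` of an operator `I` that depends differentiably on a parameter has the
derivative `A I' A`. -/
lemma hasDerivAt_neumann {I : ℝ → E →L[ℝ] E} {I' : E →L[ℝ] E}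
    (hs : ∀ ε, Summable fun n : ℕ => ‖I ε ^ n‖) (h : HasDerivAt I I' 0) :
    HasDerivAt (fun ε => neumann (I ε)) (neumann (I 0) * I' * neumann (I 0)) 0 := by
  have h1 : HasDerivAt (fun ε => (oneSubUnit (I ε) (hs ε) : E →L[ℝ] E)) (-I') 0 := h.const_sub 1
  have h2 := (hasFDerivAt_ringInverse (𝕜 := ℝ) (oneSubUnit (I 0) (hs 0))).comp_hasDerivAt
    (0 : ℝ) h1
  have h3 : (Ring.inverse ∘ fun ε => (oneSubUnit (I ε) (hs ε) : E →L[ℝ] E)) =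
      fun ε => neumann (I ε) := by
    ext1 ε
    exact Ring.inverse_unit _
  rw [h3] at h2
  refine h2.congr_deriv ?_
  rw [neg_apply, map_neg, neg_neg]
  rfl

lemma HasExpansion.hasDerivAt_neumann_apply {I : ℝ → E →L[ℝ] E} {I₀ I' : E →L[ℝ] E}
    (h : HasExpansion I I₀ I') (hs : ∀ ε, Summable fun n : ℕ => ‖I ε ^ n‖) {x : ℝ → E}
    {x₀ x' : E} (hx : HasDerivAt x x' 0) (hx₀ : x 0 = x₀) :
    HasDerivAt (fun ε => neumann (I ε) (x ε)) (neumann I₀ (I' (neumann I₀ x₀) + x')) 0 := by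
  rw [map_add, ← h.apply_zero, ← hx₀]
  exact (hasDerivAt_neumann hs h.hasDerivAt).clm_apply hx

end Neumann

/-! ### The Volterra operator of two paths -/

section Operator

open scoped Topology

variable {H : Type} [NormedAddCommGroup H] [InnerProductSpace ℝ H] [CompleteSpace H]
  {T t s : ℝ} {X Y : ℝ → H}

/-- The extension of a continuous function on `[t, T] × [s, T]` to the plane that is constant in
each variable outside the interval. -/
def planeExtend (htT : t ≤ T) (hsT : s ≤ T) (F : C(Icc t T × Icc s T, ℝ)) : ℝ → ℝ → ℝ :=
  fun u v => F (projIcc t T htT u, projIcc s T hsT v)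

lemma isBCIntegrand_planeExtend (htT : t ≤ T) (hsT : s ≤ T) (F : C(Icc t T × Icc s T, ℝ)) :
    IsBCIntegrand (planeExtend htT hsT F) ‖F‖ where
  continuous := F.continuous.comp
    ((continuous_projIcc.comp continuous_fst).prodMk (continuous_projIcc.comp continuous_snd))
  bound u v := F.norm_coe_le_norm (projIcc t T htT u, projIcc s T hsT v)

lemma planeExtend_of_mem (htT : t ≤ T) (hsT : s ≤ T) (F : C(Icc t T × Icc s T, ℝ)) {u v : ℝ}
    (hu : u ∈ Icc t T) (hv : v ∈ Icc s T) : planeExtend htT hsT F u v = F (⟨u, hu⟩, ⟨v, hv⟩) := by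
  rw [planeExtend, projIcc_of_mem _ hu, projIcc_of_mem _ hv]

lemma abs_doubleIntegral_planeExtend_le (htT : t ≤ T) (hsT : s ≤ T) (hX : IsBVPath t T X)
    (hY : IsBVPath s T Y) (F : C(Icc t T × Icc s T, ℝ)) (p : Icc t T × Icc s T) :
    |doubleIntegral T t s (planeExtend htT hsT F) X Y p.1 p.2| ≤
      (dPath t T X).variation.real univ * (dPath s T Y).variation.real univ * ‖F‖ := by
  have := hX.isFiniteMeasure htT
  refine (abs_doubleIntegral_le hX htT hY hsT (w := fun _ => ‖F‖) (integrable_const _)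
    (fun u _ v _ => (isBCIntegrand_planeExtend htT hsT F).bound u v)
    fun _ _ => norm_nonneg _).trans ?_
  rw [setIntegral_const, smul_eq_mul, mul_right_comm]
  exact mul_le_mul_of_nonneg_right (mul_le_mul_of_nonneg_right
    (measureReal_mono (subset_univ _)) measureReal_nonneg) (norm_nonneg _)

lemma continuous_doubleIntegral_planeExtend (htT : t ≤ T) (hsT : s ≤ T) (hX : IsBVPath t T X)
    (hY : IsBVPath s T Y) (F : C(Icc t T × Icc s T, ℝ)) :
    Continuous fun p : Icc t T × Icc s T =>
      doubleIntegral T t s (planeExtend htT hsT F) X Y p.1 p.2 := by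
  have h := ((isBCIntegrand_planeExtend htT hsT F).continuous_doubleIntegral hX htT hY hsT).comp
    (by fun_prop : Continuous fun p : Icc t T × Icc s T => ((p.1 : ℝ), (p.2 : ℝ)))
  simpa only [Function.comp_def] using h

lemma doubleIntegral_planeExtend_add_smul (htT : t ≤ T) (hsT : s ≤ T) (hX : IsBVPath t T X)
    (hY : IsBVPath s T Y) (F G : C(Icc t T × Icc s T, ℝ)) (c r q : ℝ) :
    doubleIntegral T t s (planeExtend htT hsT (F + c • G)) X Y r q =
      doubleIntegral T t s (planeExtend htT hsT F) X Y r q +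
        c * doubleIntegral T t s (planeExtend htT hsT G) X Y r q :=
  (isBCIntegrand_planeExtend htT hsT F).doubleIntegral_add_smul
    (isBCIntegrand_planeExtend htT hsT G) c hX htT hY hsT r q

/-- The Volterra operator `F ↦ ((r, q) ↦ ∫_s^q ∫_t^r F(u, v) ⟨dX_u, dY_v⟩)` on the Banach space of
continuous functions on `[t, T] × [s, T]`. -/
def volterra (htT : t ≤ T) (hsT : s ≤ T) (hX : IsBVPath t T X) (hY : IsBVPath s T Y) :
    C(Icc t T × Icc s T, ℝ) →L[ℝ] C(Icc t T × Icc s T, ℝ) :=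
  LinearMap.mkContinuous
    { toFun F := ⟨fun p => doubleIntegral T t s (planeExtend htT hsT F) X Y p.1 p.2,
        continuous_doubleIntegral_planeExtend htT hsT hX hY F⟩
      map_add' F G := by
        refine ContinuousMap.ext fun p => ?_
        have h := doubleIntegral_planeExtend_add_smul htT hsT hX hY F G 1 p.1 p.2
        rw [one_smul, one_mul] at h
        exact h
      map_smul' c F := by
        refine ContinuousMap.ext fun p => ?_
        have h := doubleIntegral_planeExtend_add_smul htT hsT hX hY 0 F c p.1 p.2
        have h0 := doubleIntegral_planeExtend_add_smul htT hsT hX hY 0 0 1 p.1 p.2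
        rw [smul_zero, add_zero, one_mul] at h0
        rw [left_eq_add.1 h0, zero_add, zero_add] at h
        exact h }
    ((dPath t T X).variation.real univ * (dPath s T Y).variation.real univ) fun F => by
      refine (ContinuousMap.norm_le _ (by positivity)).2 fun p => ?_
      exact abs_doubleIntegral_planeExtend_le htT hsT hX hY F p

lemma volterra_apply (htT : t ≤ T) (hsT : s ≤ T) (hX : IsBVPath t T X) (hY : IsBVPath s T Y)
    (F : C(Icc t T × Icc s T, ℝ)) (p : Icc t T × Icc s T) :
    volterra htT hsT hX hY F p = doubleIntegral T t s (planeExtend htT hsT F) X Y p.1 p.2 := rfl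

lemma norm_volterra_le (htT : t ≤ T) (hsT : s ≤ T) (hX : IsBVPath t T X) (hY : IsBVPath s T Y) :
    ‖volterra htT hsT hX hY‖ ≤
      (dPath t T X).variation.real univ * (dPath s T Y).variation.real univ :=
  LinearMap.mkContinuous_norm_le _ (by positivity) _

lemma volterra_add_smul (htT : t ≤ T) (hsT : s ≤ T) {X' Z : ℝ → H} (hX : IsBVPath t T X)
    (hX' : IsBVPath t T X') (hZ : IsBVPath t T Z) (hY : IsBVPath s T Y) (c : ℝ)
    (h : EqOn Z (X + c • X') (Icc t T)) :
    volterra htT hsT hZ hY = volterra htT hsT hX hY + c • volterra htT hsT hX' hY := by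
  ext F p
  exact (isBCIntegrand_planeExtend htT hsT F).doubleIntegral_path_add_smul hX hX' htT hY hsT c h
    p.1 p.2

/-- The factorial decay of the iterated integrals. It comes from the first path alone: for its
variation measure `m`, the integral of `m(t, u]ⁿ` is `m(t, r]ⁿ⁺¹ / (n + 1)`. -/
lemma abs_volterra_pow_apply_le (htT : t ≤ T) (hsT : s ≤ T) (hX : IsBVPath t T X)
    (hY : IsBVPath s T Y) (F : C(Icc t T × Icc s T, ℝ)) (n : ℕ) (p : Icc t T × Icc s T) :
    |(volterra htT hsT hX hY ^ n) F p| ≤ ‖F‖ * (dPath s T Y).variation.real univ ^ n / n.factorial *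
      (dPath t T X).variation.real (Ioc t p.1) ^ n := by
  have := hX.isFiniteMeasure htT
  have := hX.noAtoms htT
  induction n generalizing p with
  | zero => simpa using F.norm_coe_le_norm p
  | succ n ih =>
    set m := (dPath t T X).variation
    set c := ‖F‖ * (dPath s T Y).variation.real univ ^ n / n.factorial with hc
    have hc0 : 0 ≤ c := by positivity
    rw [pow_succ', mul_apply_eq_comp, volterra_apply]
    refine (abs_doubleIntegral_le hX htT hY hsT (w := fun u => c * m.real (Ioc t u) ^ n)
      ((integrableOn_measureReal_Ioc_pow m t p.1 n).const_mul c) (fun u hu v hv => ?_)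
      fun u _ => by positivity).trans (le_of_eq ?_)
    · have hu' : u ∈ Icc t T := ⟨hu.1.le, hu.2.trans p.1.2.2⟩
      have hv' : v ∈ Icc s T := ⟨hv.1.le, hv.2.trans p.2.2.2⟩
      rw [planeExtend_of_mem htT hsT _ hu' hv']
      exact ih _
    · rw [integral_const_mul, setIntegral_measureReal_Ioc_pow m p.1.2.1, hc, Nat.factorial_succ]
      push_cast
      field_simp
      ring

lemma norm_volterra_pow_le (htT : t ≤ T) (hsT : s ≤ T) (hX : IsBVPath t T X)
    (hY : IsBVPath s T Y) (n : ℕ) : ‖volterra htT hsT hX hY ^ n‖ ≤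
      ((dPath s T Y).variation.real univ * (dPath t T X).variation.real univ) ^ n /
        n.factorial := by
  have := hX.isFiniteMeasure htT
  refine ContinuousLinearMap.opNorm_le_bound _ (by positivity) fun F => ?_
  refine (ContinuousMap.norm_le _ (by positivity)).2 fun p => ?_
  refine (abs_volterra_pow_apply_le htT hsT hX hY F n p).trans ?_
  calc _ ≤ ‖F‖ * (dPath s T Y).variation.real univ ^ n / n.factorial *
        (dPath t T X).variation.real univ ^ n := by
        exact mul_le_mul_of_nonneg_left (pow_le_pow_left₀ measureReal_nonneg
          (measureReal_mono (subset_univ _)) n) (by positivity)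
    _ = _ := by rw [mul_pow]; ring

lemma summable_norm_volterra_pow (htT : t ≤ T) (hsT : s ≤ T) (hX : IsBVPath t T X)
    (hY : IsBVPath s T Y) : Summable fun n => ‖volterra htT hsT hX hY ^ n‖ :=
  Summable.of_nonneg_of_le (fun _ => ContinuousLinearMap.opNorm_nonneg _) (norm_volterra_pow_le htT hsT hX hY)
    (Real.summable_pow_div_factorial _)

/-- The Volterra operator is differentiable along a family of paths which is differentiable for the
total variation norm. The variation of the remainder is controlled by that of a path `p`. -/
lemma hasExpansion_volterra {F : Type*} [NormedAddCommGroup F] (htT : t ≤ T) (hsT : s ≤ T)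
    {Xε : ℝ → ℝ → H} {X' : ℝ → H} (hXε : ∀ ε, IsBVPath t T (Xε ε)) (hX : IsBVPath t T X)
    (hX' : IsBVPath t T X') (hY : IsBVPath s T Y) {p : ℝ → F} (hp : IsBVPath t T p) {c : ℝ}
    (hc : 0 ≤ c) (h : ∀ ε : ℝ, |ε| ≤ 1 → ∀ u ∈ Icc t T, ∀ v ∈ Icc t T,
      ‖(Xε ε - X - ε • X') u - (Xε ε - X - ε • X') v‖ ≤ c * ε ^ 2 * ‖p u - p v‖) :
    HasExpansion (fun ε => volterra htT hsT (hXε ε) hY) (volterra htT hsT hX hY)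
      (volterra htT hsT hX' hY) := by
  refine ⟨c * (eVariationOn p (Icc t T)).toReal * (dPath s T Y).variation.real univ,
    fun ε hε => ?_⟩
  have hR : IsBVPath t T (Xε ε - X - ε • X') := ((hXε ε).sub hX).sub (hX'.const_smul ε)
  have hZ : IsBVPath t T (X + ε • X') := hX.add_smul hX' ε
  have e1 := volterra_add_smul htT hsT hX hX' hZ hY ε (fun _ _ => rfl)
  have e2 := volterra_add_smul htT hsT hZ hR (hXε ε) hY 1 (fun u _ => by
    simp only [Pi.add_apply, Pi.smul_apply, Pi.sub_apply, one_smul]; abel)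
  have e3 : volterra htT hsT (hXε ε) hY - volterra htT hsT hX hY -
      ε • volterra htT hsT hX' hY = volterra htT hsT hR hY := by
    rw [e2, e1, one_smul, add_assoc, add_sub_cancel_left, add_sub_cancel_left]
  rw [e3]
  refine (norm_volterra_le htT hsT hR hY).trans ?_
  have hcε : 0 ≤ c * ε ^ 2 := by positivity
  have hvar : (dPath t T (Xε ε - X - ε • X')).variation.real univ ≤
      c * ε ^ 2 * (eVariationOn p (Icc t T)).toReal := by
    have h1 := (hR.variation_dPath_le htT).trans (eVariationOn_le_of_norm_sub_le hcε (h ε hε))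
    have h2 := ENNReal.toReal_mono (ENNReal.mul_ne_top ENNReal.ofReal_ne_top hp.2) h1
    rwa [ENNReal.toReal_mul, ENNReal.toReal_ofReal hcε] at h2
  refine (mul_le_mul_of_nonneg_right hvar measureReal_nonneg).trans (le_of_eq ?_)
  ring

end Operator

/-! ### Inner products of iterated integrals -/

section InnerIntegral

variable {H A A' : Type*} [NormedAddCommGroup H] [InnerProductSpace ℝ H] [CompleteSpace H]
  [NormedAddCommGroup A] [InnerProductSpace ℝ A]
  [NormedAddCommGroup A'] [InnerProductSpace ℝ A'] [CompleteSpace A']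

/-- For a bilinear map `(b, k) ↦ b ⊗ k` and a vector `w`, the operator `b ↦ (b ⊗ ·)* w`. -/
def contraction (ten : A →L[ℝ] H →L[ℝ] A') (w : A') : A →L[ℝ] H :=
  LinearMap.mkContinuous
    { toFun b := ContinuousLinearMap.adjoint (ten b) w
      map_add' b b' := by simp
      map_smul' c b := by simp }
    (‖ten‖ * ‖w‖) fun b => by
      refine ((ContinuousLinearMap.adjoint (ten b)).le_opNorm w).trans ?_
      rw [LinearIsometryEquiv.norm_map, mul_right_comm]
      exact mul_le_mul_of_nonneg_right (ten.le_opNorm b) (norm_nonneg _)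

lemma inner_contraction (ten : A →L[ℝ] H →L[ℝ] A') (w : A') (b : A) (k : H) :
    inner ℝ (contraction ten w b) k = inner ℝ w (ten b k) :=
  ContinuousLinearMap.adjoint_inner_left (ten b) k w

/-- If `⟨a ⊗ h, b ⊗ k⟩ = ⟨a, b⟩ ⟨h, k⟩`, then
`⟨∫ f(u) ⊗ dμ(u), ∫ g(v) ⊗ dν(v)⟩ = ∫∫ ⟨f(u), g(v)⟩ ⟨dμ(u), dν(v)⟩`. -/
lemma inner_integral_integral (ten : A →L[ℝ] H →L[ℝ] A')
    (hten : ∀ a h b k, inner ℝ (ten a h) (ten b k) = inner ℝ a b * inner ℝ h k)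
    {μ ν : VectorMeasure ℝ H} {f g : ℝ → A} (hf : Integrable f μ.variation)
    (hg : Integrable g ν.variation) :
    inner ℝ (μ.integral f ten) (ν.integral g ten) =
      ν.integral (fun v => μ.integral (fun u => inner ℝ (f u) (g v))
        (ContinuousLinearMap.lsmul ℝ ℝ)) (innerSL ℝ) := by
  have hJ : ∀ b : A, μ.integral (fun u => inner ℝ (f u) b) (ContinuousLinearMap.lsmul ℝ ℝ) =
      contraction ten (μ.integral f ten) b := by
    intro b
    refine ext_inner_right ℝ fun k => ?_
    rw [inner_contraction]
    have h1 := VectorMeasure.continuousLinearMap_apply_integral (B := ten)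
      (C := (innerSL ℝ).flip (ten b k)) hf
    have h2 := VectorMeasure.continuousLinearMap_apply_integral
      (B := (ContinuousLinearMap.lsmul ℝ ℝ : ℝ →L[ℝ] H →L[ℝ] H))
      (C := (innerSL ℝ).flip k) (((innerSL ℝ).flip b).integrable_comp hf)
    refine (h2.trans ((VectorMeasure.integral_continuousLinearMap_comp hf).trans ?_)).trans h1.symm
    congr 1
    ext a h
    change inner ℝ (inner ℝ a b • h) k = inner ℝ (ten a h) (ten b k)
    rw [hten, real_inner_smul_left]
  have hC := VectorMeasure.continuousLinearMap_apply_integral (B := ten)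
      (C := innerSL ℝ (μ.integral f ten)) hg
  simp only [hJ]
  refine hC.trans ?_
  rw [VectorMeasure.integral_continuousLinearMap_comp hg]
  congr 1
  ext b k
  exact (inner_contraction _ _ _ _).symm

end InnerIntegral

/-! ### The signature kernel as a resolvent -/

section Signature

variable {H : Type} [NormedAddCommGroup H] [InnerProductSpace ℝ H] [CompleteSpace H]
  {T t s : ℝ} {X Y : ℝ → H}

omit [CompleteSpace H] in
lemma inner_tensorMul (n : ℕ) (a b : TPow H n) (h k : H) :
    inner ℝ (tensorMul H n a h) (tensorMul H n b k) = inner ℝ a b * inner ℝ h k := by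
  have h1 : inner ℝ ((a ⊗ₜ[ℝ] h : TPow H n ⊗[ℝ] H) : UniformSpace.Completion (TPow H n ⊗[ℝ] H))
      ((b ⊗ₜ[ℝ] k : TPow H n ⊗[ℝ] H) : UniformSpace.Completion (TPow H n ⊗[ℝ] H)) =
      inner ℝ a b * inner ℝ h k := by
    rw [UniformSpace.Completion.inner_coe, TensorProduct.inner_tmul]
  exact h1

lemma continuous_signature_and_bounded (hX : IsBVPath t T X) (htT : t ≤ T) (n : ℕ) :
    Continuous (signature t T X n) ∧ ∃ C, ∀ u, ‖signature t T X n u‖ ≤ C := by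
  have := hX.isFiniteMeasure htT
  have := hX.noAtoms htT
  induction n with
  | zero => exact ⟨continuous_const, ‖tensorOne H‖, fun _ => le_rfl⟩
  | succ n ih =>
    obtain ⟨hc, C, hC⟩ := ih
    have hC0 : 0 ≤ C := (norm_nonneg _).trans (hC 0)
    refine ⟨continuous_setIntegral_Ioc (P := ℝ) (tensorMul H n) t continuous_id
      (f := fun _ => signature t T X n) (fun _ => hc.stronglyMeasurable) (fun _ u => hC u)
      fun _ => continuous_const,
      C * ‖tensorMul H n‖ * (dPath t T X).variation.real univ, fun u => ?_⟩
    refine (VectorMeasure.norm_setIntegral_le_of_norm_le_const (C := C)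
      fun u _ => hC u).trans ?_
    exact mul_le_mul_of_nonneg_left (measureReal_mono (subset_univ _)) (by positivity)

lemma integrable_signature (hX : IsBVPath t T X) (htT : t ≤ T) (n : ℕ) (m : Measure ℝ)
    [IsFiniteMeasure m] : Integrable (signature t T X n) m := by
  obtain ⟨hc, C, hC⟩ := continuous_signature_and_bounded hX htT n
  exact Integrable.of_bound hc.stronglyMeasurable.aestronglyMeasurable C
    (Filter.Eventually.of_forall hC)

lemma inner_signature_succ (hX : IsBVPath t T X) (htT : t ≤ T) (hY : IsBVPath s T Y)
    (hsT : s ≤ T) (n : ℕ) (r q : ℝ) :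
    inner ℝ (signature t T X (n + 1) r) (signature s T Y (n + 1) q) =
      doubleIntegral T t s (fun u v => inner ℝ (signature t T X n u) (signature s T Y n v))
        X Y r q := by
  have := hX.isFiniteMeasure htT
  have := hY.isFiniteMeasure hsT
  have h1 : Integrable (signature t T X n) ((dPath t T X).restrict (Ioc t r)).variation := by
    rw [VectorMeasure.variation_restrict measurableSet_Ioc]
    exact integrable_signature hX htT n _
  have h2 : Integrable (signature s T Y n) ((dPath s T Y).restrict (Ioc s q)).variation := by
    rw [VectorMeasure.variation_restrict measurableSet_Ioc]
    exact integrable_signature hY hsT n _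
  exact inner_integral_integral (tensorMul H n) (fun a h b k => inner_tensorMul n a b h k) h1 h2

lemma inner_signature (htT : t ≤ T) (hsT : s ≤ T) (hX : IsBVPath t T X) (hY : IsBVPath s T Y)
    (n : ℕ) (p : Icc t T × Icc s T) :
    inner ℝ (signature t T X n p.1) (signature s T Y n p.2) =
      (volterra htT hsT hX hY ^ n) 1 p := by
  induction n generalizing p with
  | zero =>
    change (inner ℝ (1 : ℝ) (1 : ℝ) : ℝ) = 1
    simp
  | succ n ih =>
    rw [pow_succ', mul_apply_eq_comp, volterra_apply, inner_signature_succ hX htT hY hsT]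
    refine doubleIntegral_congr fun u hu v hv => ?_
    have hu' : u ∈ Icc t T := ⟨hu.1.le, hu.2.trans p.1.2.2⟩
    have hv' : v ∈ Icc s T := ⟨hv.1.le, hv.2.trans p.2.2.2⟩
    rw [planeExtend_of_mem htT hsT _ hu' hv']
    exact ih (⟨u, hu'⟩, ⟨v, hv'⟩)

/-- The series of the signature kernel is the Neumann series `∑ Iⁿ 1`; its sum solves the Volterra
equation `κ = 1 + I κ`. -/
lemma hasSum_sigKernel (htT : t ≤ T) (hsT : s ≤ T) (hX : IsBVPath t T X) (hY : IsBVPath s T Y)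
    (p : Icc t T × Icc s T) :
    HasSum (fun n => inner ℝ (signature t T X n p.1) (signature s T Y n p.2))
      (neumann (volterra htT hsT hX hY) 1 p) := by
  simp only [inner_signature htT hsT hX hY]
  exact (ContinuousMap.evalCLM ℝ p).hasSum
    (hasSum_neumann_apply (summable_norm_volterra_pow htT hsT hX hY) 1)

lemma sigKernel_eq (htT : t ≤ T) (hsT : s ≤ T) (hX : IsBVPath t T X) (hY : IsBVPath s T Y)
    (p : Icc t T × Icc s T) :
    sigKernel T t s X Y p.1 p.2 = neumann (volterra htT hsT hX hY) 1 p :=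
  (hasSum_sigKernel htT hsT hX hY p).tsum_eq

/-- The squared norms of the iterated integrals are the terms of the signature kernel of `X` with
itself on the diagonal. -/
lemma memℓp_signature (hX : IsBVPath t T X) {r : ℝ} (hr : r ∈ Icc t T) :
    Memℓp (fun n => signature t T X n r) 2 := by
  have htT : t ≤ T := hr.1.trans hr.2
  refine memℓp_gen ?_
  have h := (hasSum_sigKernel htT htT hX hX (⟨r, hr⟩, ⟨r, hr⟩)).summable
  simp only [real_inner_self_eq_norm_sq] at h
  exact_mod_cast h

end Signature

/-! ### Derivatives of the lifted paths -/

section ClmApply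

variable {E E' F : Type*} [NormedAddCommGroup E] [NormedSpace ℝ E] [NormedAddCommGroup E']
  [NormedSpace ℝ E'] [NormedAddCommGroup F] {a b : ℝ}

lemma norm_clm_apply_sub_le (L L' : E →L[ℝ] E') (x x' : E) :
    ‖L x - L' x'‖ ≤ ‖L - L'‖ * ‖x‖ + ‖L'‖ * ‖x - x'‖ := by
  calc ‖L x - L' x'‖ = ‖(L - L') x + L' (x - x')‖ := by
        rw [sub_apply, map_sub]; congr 1; abel
    _ ≤ _ := (norm_add_le _ _).trans (add_le_add ((L - L').le_opNorm x) (L'.le_opNorm _))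

lemma IsBVPath.clm_apply {L : ℝ → E →L[ℝ] E'} {x : ℝ → E} (hL : IsBVPath a b L)
    (hx : IsBVPath a b x) : IsBVPath a b (fun u => L u (x u)) := by
  obtain ⟨M, hM0, hM⟩ := hx.exists_norm_le
  obtain ⟨M', hM0', hM'⟩ := hL.exists_norm_le
  refine (hL.prodMk hx).of_norm_sub_le (c := M + M') (by positivity) fun u hu v hv => ?_
  have h1 : ‖L u - L v‖ ≤ ‖(L u, x u) - (L v, x v)‖ := norm_fst_le ((L u, x u) - (L v, x v))
  have h2 : ‖x u - x v‖ ≤ ‖(L u, x u) - (L v, x v)‖ := norm_snd_le ((L u, x u) - (L v, x v))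
  refine (norm_clm_apply_sub_le _ _ _ _).trans ?_
  rw [add_mul, mul_comm M]
  exact add_le_add (mul_le_mul h1 (hM u hu) (norm_nonneg _) (norm_nonneg _))
    (mul_le_mul (hM' v hv) h2 (norm_nonneg _) hM0')

/-- Along paths `γ`, `η` bounded by `M`, the Taylor remainder of order `ε²` also has increments of
order `ε²`. -/
lemma norm_taylorRem_path_sub_le [CompleteSpace E'] {C : ℝ} {f : E → E'} (hf : DiffBound 3 C f)
    {f' : E → E →L[ℝ] E'} (hf' : ∀ x, HasFDerivAt f (f' x) x) (hb : DiffBound 2 C f')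
    {γ η : ℝ → E} {M : ℝ} (hM0 : 0 ≤ M) {u v : ℝ} (hu : ‖η u‖ ≤ M) (hv : ‖η v‖ ≤ M) (ε : ℝ)
    {d : ℝ} (hγ : ‖γ u - γ v‖ ≤ d) (hη : ‖η u - η v‖ ≤ d) :
    ‖taylorRem f f' (γ u) (ε • η u) - taylorRem f f' (γ v) (ε • η v)‖ ≤
      C * (M ^ 2 + 4 * M) * ε ^ 2 * d := by
  have hC := hf.nonneg
  refine (norm_taylorRem_sub_le hf hf' hb.norm_sub_le _ _ _ _).trans ?_
  have h1 : ‖ε • η u‖ ≤ |ε| * M := by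
    rw [norm_smul, Real.norm_eq_abs]; gcongr
  have h2 : ‖ε • η v‖ ≤ |ε| * M := by
    rw [norm_smul, Real.norm_eq_abs]; gcongr
  have h3 : ‖ε • η u - ε • η v‖ ≤ |ε| * d := by
    rw [← smul_sub, norm_smul, Real.norm_eq_abs]; gcongr
  calc C * (‖ε • η u‖ ^ 2 * ‖γ u - γ v‖ + 2 * (‖ε • η u‖ + ‖ε • η v‖) * ‖ε • η u - ε • η v‖)
      ≤ C * ((|ε| * M) ^ 2 * d + 2 * (|ε| * M + |ε| * M) * (|ε| * d)) := by gcongr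
    _ = C * (M ^ 2 + 4 * M) * |ε| ^ 2 * d := by ring
    _ = _ := by rw [sq_abs]

end ClmApply

section Lift

variable {e : ℕ} {H : Type} [NormedAddCommGroup H] [InnerProductSpace ℝ H] [CompleteSpace H]
  [RKHS ℝ H (V e) ℝ]

/-- The first two derivatives `φ'`, `φ''` of the feature map `φ`, with bounds for the finite
differences of `φ`, `φ'` and `φ''`. -/
structure IsFeatureDeriv (C : ℝ) (φ' : V e → V e →L[ℝ] H) (φ'' : V e → V e →L[ℝ] V e →L[ℝ] H) :
    Prop where
  diffBound : DiffBound 4 C (feature (e := e) H)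
  diffBound' : DiffBound 3 C φ'
  diffBound'' : DiffBound 2 C φ''
  hasFDerivAt : ∀ x, HasFDerivAt (feature H) (φ' x) x
  hasFDerivAt' : ∀ x, HasFDerivAt φ' (φ'' x) x

lemma StaticKernelAssumption.exists_isFeatureDeriv {g : V e → V e → ℝ}
    (hg : StaticKernelAssumption g) (hH : ∀ x y, RKHS.kerFun H x (1 : ℝ) y = g x y) :
    ∃ C φ' φ'', IsFeatureDeriv (H := H) (e := e) C φ' φ'' := by
  obtain ⟨C, h⟩ := exists_diffBound_feature H hg hH
  obtain ⟨φ', h', hd⟩ := h.exists_hasFDerivAt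
  obtain ⟨φ'', h'', hd'⟩ := h'.exists_hasFDerivAt
  exact ⟨C, φ', φ'', h, h', h'', hd, hd'⟩

namespace IsFeatureDeriv

variable {C : ℝ} {φ' : V e → V e →L[ℝ] H} {φ'' : V e → V e →L[ℝ] V e →L[ℝ] H}
  {T t s : ℝ} {γ η η' τ : ℝ → V e}

section
variable (D : IsFeatureDeriv C φ' φ'')
include D

lemma isBVPath_lift (hγ : IsBVPath t T γ) : IsBVPath t T (lift H γ) :=
  hγ.of_norm_sub_le D.diffBound.nonneg fun _ _ _ _ => D.diffBound.norm_sub_le _ _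

lemma hasLineDerivAt_lift (γ η : ℝ → V e) (u : ℝ) :
    HasLineDerivAt ℝ (fun γ' => lift H γ' u) (φ' (γ u) (η u)) γ η :=
  (D.hasFDerivAt (γ u)).hasLineDerivAt (η u)

lemma dLift_apply (γ η : ℝ → V e) (u : ℝ) : dLift H η γ u = φ' (γ u) (η u) :=
  (D.hasLineDerivAt_lift γ η u).lineDeriv

lemma isBVPath_dLift (hη : IsBVPath t T η) (hγ : IsBVPath t T γ) :
    IsBVPath t T (dLift H η γ) := by
  rw [funext (D.dLift_apply γ η)]
  exact (hγ.of_norm_sub_le (X := fun u => φ' (γ u)) D.diffBound'.nonneg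
    fun _ _ _ _ => D.diffBound'.norm_sub_le _ _).clm_apply hη

lemma hasLineDerivAt_dLift (γ η η' : ℝ → V e) (u : ℝ) :
    HasLineDerivAt ℝ (fun γ' => dLift H η γ' u) (φ'' (γ u) (η' u) (η u)) γ η' := by
  simp only [D.dLift_apply]
  exact ((ContinuousLinearMap.apply ℝ H (η u)).hasFDerivAt.comp _
    (D.hasFDerivAt' (γ u))).hasLineDerivAt (η' u)

lemma ddLift_apply (γ η η' : ℝ → V e) (u : ℝ) :
    ddLift H η η' γ u = φ'' (γ u) (η' u) (η u) :=
  (D.hasLineDerivAt_dLift γ η η' u).lineDeriv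

lemma isBVPath_ddLift (hη : IsBVPath t T η) (hη' : IsBVPath t T η') (hγ : IsBVPath t T γ) :
    IsBVPath t T (ddLift H η η' γ) := by
  rw [funext (D.ddLift_apply γ η η')]
  exact ((hγ.of_norm_sub_le (X := fun u => φ'' (γ u)) D.diffBound''.nonneg
    fun _ _ _ _ => D.diffBound''.norm_sub_le _ _).clm_apply hη').clm_apply hη

end

/-- The lift is differentiable for the total variation norm, in the sense that its Volterra
operator is differentiable. -/
lemma hasExpansion_volterra_lift (D : IsFeatureDeriv C φ' φ'') (htT : t ≤ T) (hsT : s ≤ T)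
    (hγ : IsBVPath t T γ) (hη : IsBVPath t T η) {Y : ℝ → H} (hY : IsBVPath s T Y) :
    HasExpansion (fun ε => volterra htT hsT (D.isBVPath_lift (hγ.add_smul hη ε)) hY)
      (volterra htT hsT (D.isBVPath_lift hγ) hY)
      (volterra htT hsT (D.isBVPath_dLift hη hγ) hY) := by
  obtain ⟨M, hM0, hM⟩ := hη.exists_norm_le
  have hC := D.diffBound.nonneg
  refine hasExpansion_volterra htT hsT _ _ _ hY (hγ.prodMk hη)
    (c := C * (M ^ 2 + 4 * M)) (by positivity) fun ε _ u hu v hv => ?_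
  have hR : ∀ u, (lift H (γ + ε • η) - lift H γ - ε • dLift H η γ) u =
      taylorRem (feature H) φ' (γ u) (ε • η u) := fun u => by
    simp only [Pi.sub_apply, Pi.smul_apply, D.dLift_apply, taylorRem, map_smul]
    rfl
  rw [hR, hR]
  exact norm_taylorRem_path_sub_le (D.diffBound.mono (by norm_num)) D.hasFDerivAt
    (D.diffBound'.mono (by norm_num)) hM0 (hM u hu) (hM v hv) ε
    (norm_fst_le ((γ u, η u) - (γ v, η v))) (norm_snd_le ((γ u, η u) - (γ v, η v)))

lemma hasExpansion_volterra_dLift (D : IsFeatureDeriv C φ' φ'') (htT : t ≤ T) (hsT : s ≤ T)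
    (hγ : IsBVPath t T γ) (hη : IsBVPath t T η) (hη' : IsBVPath t T η') {Y : ℝ → H}
    (hY : IsBVPath s T Y) :
    HasExpansion (fun ε => volterra htT hsT (D.isBVPath_dLift hη (hγ.add_smul hη' ε)) hY)
      (volterra htT hsT (D.isBVPath_dLift hη hγ) hY)
      (volterra htT hsT (D.isBVPath_ddLift hη hη' hγ) hY) := by
  obtain ⟨M, hM0, hM⟩ := hη.exists_norm_le
  obtain ⟨M', hM0', hM'⟩ := hη'.exists_norm_le
  have hC := D.diffBound.nonneg
  refine hasExpansion_volterra htT hsT _ _ _ hY (hγ.prodMk (hη'.prodMk hη))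
    (c := C * (M' ^ 2 + 4 * M') * M + C * M' ^ 2) (by positivity) fun ε _ u hu v hv => ?_
  have hR : ∀ u, (dLift H η (γ + ε • η') - dLift H η γ - ε • ddLift H η η' γ) u =
      taylorRem φ' φ'' (γ u) (ε • η' u) (η u) := fun u => by
    simp only [Pi.sub_apply, Pi.smul_apply, D.dLift_apply, D.ddLift_apply, taylorRem, map_smul,
      Pi.add_apply, sub_apply, smul_apply]
  rw [hR, hR]
  set d := ‖(γ u, (η' u, η u)) - (γ v, (η' v, η v))‖ with hd
  have hd0 : 0 ≤ d := norm_nonneg _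
  have h1 : ‖γ u - γ v‖ ≤ d := norm_fst_le ((γ u, (η' u, η u)) - (γ v, (η' v, η v)))
  have h2 : ‖(η' u, η u) - (η' v, η v)‖ ≤ d :=
    norm_snd_le ((γ u, (η' u, η u)) - (γ v, (η' v, η v)))
  have h3 : ‖η' u - η' v‖ ≤ d := (norm_fst_le ((η' u, η u) - (η' v, η v))).trans h2
  have h4 : ‖η u - η v‖ ≤ d := (norm_snd_le ((η' u, η u) - (η' v, η v))).trans h2
  have h5 := norm_taylorRem_path_sub_le D.diffBound' D.hasFDerivAt' D.diffBound'' hM0'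
    (hM' u hu) (hM' v hv) ε h1 h3
  have h6 : ‖taylorRem φ' φ'' (γ v) (ε • η' v)‖ ≤ C * (M' ^ 2 * ε ^ 2) := by
    refine (norm_taylorRem_le (D.diffBound'.mono (by norm_num)) D.hasFDerivAt' _ _).trans ?_
    rw [norm_smul, mul_pow, Real.norm_eq_abs, sq_abs, mul_comm (ε ^ 2)]
    gcongr
    exact hM' v hv
  calc _ ≤ C * (M' ^ 2 + 4 * M') * ε ^ 2 * d * M + C * (M' ^ 2 * ε ^ 2) * d :=
        (norm_clm_apply_sub_le _ _ _ _).trans (add_le_add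
          (mul_le_mul h5 (hM u hu) (norm_nonneg _) (by positivity))
          (mul_le_mul h6 h4 (norm_nonneg _) (by positivity)))
    _ = _ := by ring

end IsFeatureDeriv

end Lift

/-! ### Derivatives of the lifted signature kernel -/

section Grid

variable {H : Type} [NormedAddCommGroup H] [InnerProductSpace ℝ H] [CompleteSpace H]
  {T t s : ℝ} {X Y : ℝ → H}

lemma volterra_apply_of_eq (htT : t ≤ T) (hsT : s ≤ T) (hX : IsBVPath t T X)
    (hY : IsBVPath s T Y) {F : C(Icc t T × Icc s T, ℝ)} {f : ℝ → ℝ → ℝ}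
    (h : ∀ p : Icc t T × Icc s T, f p.1 p.2 = F p) (p : Icc t T × Icc s T) :
    volterra htT hsT hX hY F p = doubleIntegral T t s f X Y p.1 p.2 := by
  rw [volterra_apply]
  refine doubleIntegral_congr fun u hu v hv => ?_
  have hu' : u ∈ Icc t T := ⟨hu.1.le, hu.2.trans p.1.2.2⟩
  have hv' : v ∈ Icc s T := ⟨hv.1.le, hv.2.trans p.2.2.2⟩
  rw [planeExtend_of_mem htT hsT _ hu' hv']
  exact (h (⟨u, hu'⟩, ⟨v, hv'⟩)).symm

lemma continuousOn_of_eq (htT : t ≤ T) (hsT : s ≤ T) {F : C(Icc t T × Icc s T, ℝ)}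
    {f : ℝ → ℝ → ℝ} (h : ∀ p : Icc t T × Icc s T, f p.1 p.2 = F p) :
    ContinuousOn (fun p : ℝ × ℝ => f p.1 p.2) (Icc t T ×ˢ Icc s T) := by
  refine (isBCIntegrand_planeExtend htT hsT F).continuous.continuousOn.congr fun p hp => ?_
  refine Eq.trans ?_ (planeExtend_of_mem htT hsT F hp.1 hp.2).symm
  exact h (⟨p.1, hp.1⟩, ⟨p.2, hp.2⟩)

end Grid

section Kernel

variable {e : ℕ} {H : Type} [NormedAddCommGroup H] [InnerProductSpace ℝ H] [CompleteSpace H]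
  [RKHS ℝ H (V e) ℝ]
  {C : ℝ} {φ' : V e → V e →L[ℝ] H} {φ'' : V e → V e →L[ℝ] V e →L[ℝ] H}
  {T t s : ℝ} {γ η η' τ : ℝ → V e}

/-- The lifted signature kernel `κ = (1 - I)⁻¹ 1` as a continuous function on `[t, T] × [s, T]`. -/
def kernelMap (D : IsFeatureDeriv C φ' φ'') (htT : t ≤ T) (hsT : s ≤ T) (hτ : IsBVPath s T τ)
    (hγ : IsBVPath t T γ) : C(Icc t T × Icc s T, ℝ) :=
  neumann (volterra htT hsT (D.isBVPath_lift hγ) (D.isBVPath_lift hτ)) 1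

/-- The derivative `(1 - I)⁻¹ I_η κ` of the lifted signature kernel. -/
def dKernelMap (D : IsFeatureDeriv C φ' φ'') (htT : t ≤ T) (hsT : s ≤ T) (hτ : IsBVPath s T τ)
    (hη : IsBVPath t T η) (hγ : IsBVPath t T γ) : C(Icc t T × Icc s T, ℝ) :=
  neumann (volterra htT hsT (D.isBVPath_lift hγ) (D.isBVPath_lift hτ))
    (volterra htT hsT (D.isBVPath_dLift hη hγ) (D.isBVPath_lift hτ) (kernelMap D htT hsT hτ hγ))

/-- The second derivative `(1 - I)⁻¹ (I_{η'} ∂^η κ + I_{η η'} κ + I_η ∂^{η'} κ)` of the lifted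
signature kernel. -/
def ddKernelMap (D : IsFeatureDeriv C φ' φ'') (htT : t ≤ T) (hsT : s ≤ T) (hτ : IsBVPath s T τ)
    (hη : IsBVPath t T η) (hη' : IsBVPath t T η') (hγ : IsBVPath t T γ) :
    C(Icc t T × Icc s T, ℝ) :=
  neumann (volterra htT hsT (D.isBVPath_lift hγ) (D.isBVPath_lift hτ))
    (volterra htT hsT (D.isBVPath_dLift hη' hγ) (D.isBVPath_lift hτ)
        (dKernelMap D htT hsT hτ hη hγ) +
      (volterra htT hsT (D.isBVPath_ddLift hη hη' hγ) (D.isBVPath_lift hτ)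
          (kernelMap D htT hsT hτ hγ) +
        volterra htT hsT (D.isBVPath_dLift hη hγ) (D.isBVPath_lift hτ)
          (dKernelMap D htT hsT hτ hη' hγ)))

variable (D : IsFeatureDeriv C φ' φ'') (htT : t ≤ T) (hsT : s ≤ T) (hτ : IsBVPath s T τ)

lemma liftedKernel_eq (hγ : IsBVPath t T γ) (p : Icc t T × Icc s T) :
    liftedKernel H T t s τ γ p.1 p.2 = kernelMap D htT hsT hτ hγ p :=
  sigKernel_eq htT hsT (D.isBVPath_lift hγ) (D.isBVPath_lift hτ) p

lemma kernelMap_zero_smul (hγ : IsBVPath t T γ) (hη : IsBVPath t T η) :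
    kernelMap D htT hsT hτ (hγ.add_smul hη 0) = kernelMap D htT hsT hτ hγ := by
  congr 1
  simp

lemma hasDerivAt_kernelMap (hγ : IsBVPath t T γ) (hη : IsBVPath t T η) :
    HasDerivAt (fun ε => kernelMap D htT hsT hτ (hγ.add_smul hη ε))
      (dKernelMap D htT hsT hτ hη hγ) 0 := by
  have h := (D.hasExpansion_volterra_lift htT hsT hγ hη
    (D.isBVPath_lift hτ)).hasDerivAt_neumann_apply
    (fun ε => summable_norm_volterra_pow htT hsT _ _)
    (hasDerivAt_const (0 : ℝ) (1 : C(Icc t T × Icc s T, ℝ))) rfl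
  rw [add_zero] at h
  exact h

lemma hasDerivAt_dKernelMap (hγ : IsBVPath t T γ) (hη : IsBVPath t T η)
    (hη' : IsBVPath t T η') :
    HasDerivAt (fun ε => dKernelMap D htT hsT hτ hη (hγ.add_smul hη' ε))
      (ddKernelMap D htT hsT hτ hη hη' hγ) 0 := by
  have hJ := D.hasExpansion_volterra_dLift htT hsT hγ hη hη' (D.isBVPath_lift hτ)
  have h0 := kernelMap_zero_smul D htT hsT hτ hγ hη'
  have h1 := hJ.hasDerivAt_apply (hasDerivAt_kernelMap D htT hsT hτ hγ hη') h0
  exact (D.hasExpansion_volterra_lift htT hsT hγ hη'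
    (D.isBVPath_lift hτ)).hasDerivAt_neumann_apply
    (fun ε => summable_norm_volterra_pow htT hsT _ _) h1
    (congrArg₂ (fun L x => L x) hJ.apply_zero h0)

lemma hasLineDerivAt_liftedKernel (hγ : IsBVPath t T γ) (hη : IsBVPath t T η)
    (p : Icc t T × Icc s T) :
    HasLineDerivAt ℝ (fun γ' => liftedKernel H T t s τ γ' p.1 p.2)
      (dKernelMap D htT hsT hτ hη hγ p) γ η := by
  have h := (ContinuousMap.evalCLM ℝ p).hasFDerivAt.comp_hasDerivAt (0 : ℝ)
    (hasDerivAt_kernelMap D htT hsT hτ hγ hη)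
  refine HasDerivAt.congr_of_eventuallyEq h (Filter.Eventually.of_forall fun ε => ?_)
  exact liftedKernel_eq D htT hsT hτ (hγ.add_smul hη ε) p

lemma dLiftedKernel_eq (hγ : IsBVPath t T γ) (hη : IsBVPath t T η) (p : Icc t T × Icc s T) :
    dLiftedKernel H T t s τ η γ p.1 p.2 = dKernelMap D htT hsT hτ hη hγ p :=
  (hasLineDerivAt_liftedKernel D htT hsT hτ hγ hη p).lineDeriv

lemma hasLineDerivAt_dLiftedKernel (hγ : IsBVPath t T γ) (hη : IsBVPath t T η)
    (hη' : IsBVPath t T η') (p : Icc t T × Icc s T) :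
    HasLineDerivAt ℝ (fun γ' => dLiftedKernel H T t s τ η γ' p.1 p.2)
      (ddKernelMap D htT hsT hτ hη hη' hγ p) γ η' := by
  have h := (ContinuousMap.evalCLM ℝ p).hasFDerivAt.comp_hasDerivAt (0 : ℝ)
    (hasDerivAt_dKernelMap D htT hsT hτ hγ hη hη')
  refine HasDerivAt.congr_of_eventuallyEq h (Filter.Eventually.of_forall fun ε => ?_)
  exact dLiftedKernel_eq D htT hsT hτ (hγ.add_smul hη' ε) hη p

lemma ddLiftedKernel_eq (hγ : IsBVPath t T γ) (hη : IsBVPath t T η) (hη' : IsBVPath t T η')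
    (p : Icc t T × Icc s T) :
    ddLiftedKernel H T t s τ η η' γ p.1 p.2 = ddKernelMap D htT hsT hτ hη hη' hγ p :=
  (hasLineDerivAt_dLiftedKernel D htT hsT hτ hγ hη hη' p).lineDeriv

include D htT hsT hτ in
lemma dLiftedKernel_eq_doubleIntegral (hγ : IsBVPath t T γ) (hη : IsBVPath t T η)
    (p : Icc t T × Icc s T) :
    dLiftedKernel H T t s τ η γ p.1 p.2 =
      doubleIntegral T t s (dLiftedKernel H T t s τ η γ) (lift H γ) (lift H τ) p.1 p.2 +
      doubleIntegral T t s (liftedKernel H T t s τ γ) (dLift H η γ) (lift H τ) p.1 p.2 := by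
  rw [← volterra_apply_of_eq htT hsT (D.isBVPath_lift hγ) (D.isBVPath_lift hτ)
      (dLiftedKernel_eq D htT hsT hτ hγ hη) p,
    ← volterra_apply_of_eq htT hsT (D.isBVPath_dLift hη hγ) (D.isBVPath_lift hτ)
      (liftedKernel_eq D htT hsT hτ hγ) p, dLiftedKernel_eq D htT hsT hτ hγ hη]
  exact congrArg (fun F => F p) (neumann_apply_eq (summable_norm_volterra_pow htT hsT
    (D.isBVPath_lift hγ) (D.isBVPath_lift hτ)) _)

include D htT hsT hτ in
lemma ddLiftedKernel_eq_doubleIntegral (hγ : IsBVPath t T γ) (hη : IsBVPath t T η)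
    (hη' : IsBVPath t T η') (p : Icc t T × Icc s T) :
    ddLiftedKernel H T t s τ η η' γ p.1 p.2 =
      doubleIntegral T t s (ddLiftedKernel H T t s τ η η' γ) (lift H γ) (lift H τ) p.1 p.2 +
      doubleIntegral T t s (dLiftedKernel H T t s τ η γ) (dLift H η' γ) (lift H τ) p.1 p.2 +
      doubleIntegral T t s (dLiftedKernel H T t s τ η' γ) (dLift H η γ) (lift H τ) p.1 p.2 +
      doubleIntegral T t s (liftedKernel H T t s τ γ) (ddLift H η η' γ) (lift H τ) p.1 p.2 := by
  have h := congrArg (fun F => F p) (neumann_apply_eq (summable_norm_volterra_pow htT hsT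
    (D.isBVPath_lift hγ) (D.isBVPath_lift hτ))
    (volterra htT hsT (D.isBVPath_dLift hη' hγ) (D.isBVPath_lift hτ)
        (dKernelMap D htT hsT hτ hη hγ) +
      (volterra htT hsT (D.isBVPath_ddLift hη hη' hγ) (D.isBVPath_lift hτ)
          (kernelMap D htT hsT hτ hγ) +
        volterra htT hsT (D.isBVPath_dLift hη hγ) (D.isBVPath_lift hτ)
          (dKernelMap D htT hsT hτ hη' hγ))))
  rw [← volterra_apply_of_eq htT hsT (D.isBVPath_lift hγ) (D.isBVPath_lift hτ)
      (ddLiftedKernel_eq D htT hsT hτ hγ hη hη') p,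
    ← volterra_apply_of_eq htT hsT (D.isBVPath_dLift hη' hγ) (D.isBVPath_lift hτ)
      (dLiftedKernel_eq D htT hsT hτ hγ hη) p,
    ← volterra_apply_of_eq htT hsT (D.isBVPath_dLift hη hγ) (D.isBVPath_lift hτ)
      (dLiftedKernel_eq D htT hsT hτ hγ hη') p,
    ← volterra_apply_of_eq htT hsT (D.isBVPath_ddLift hη hη' hγ) (D.isBVPath_lift hτ)
      (liftedKernel_eq D htT hsT hτ hγ) p, ddLiftedKernel_eq D htT hsT hτ hγ hη hη']
  simp only [ContinuousMap.add_apply] at h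
  refine h.trans ?_
  rw [add_assoc, add_assoc, add_comm (volterra htT hsT (D.isBVPath_dLift hη hγ) _ _ p)]
  rfl

end Kernel

end SigKernel

end

theorem mainTheorem5 {e : ℕ} (T : ℝ) (hT : 0 < T)
    (g : SigKernel.V e → SigKernel.V e → ℝ) (hg : SigKernel.StaticKernelAssumption g)
    (H : Type) [NormedAddCommGroup H] [InnerProductSpace ℝ H] [CompleteSpace H]
    [RKHS ℝ H (SigKernel.V e) ℝ]
    (hH : ∀ x y, RKHS.kerFun H x (1 : ℝ) y = g x y)
    (t s : ℝ) (ht : t ∈ Icc 0 T) (hs : s ∈ Icc 0 T)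
    (γ τ : ℝ → SigKernel.V e)
    (hγ : SigKernel.IsBVPath t T γ) (hτ : SigKernel.IsBVPath s T τ) :
    -- the lifted paths are BV, their signatures lie in the Hilbert tensor algebra,
    -- and the lifted kernel is continuous in its two time parameters
    (SigKernel.IsBVPath t T (SigKernel.lift H γ) ∧
      SigKernel.IsBVPath s T (SigKernel.lift H τ) ∧
      (∀ r ∈ Icc t T,
        Memℓp (fun n => SigKernel.signature t T (SigKernel.lift H γ) n r) 2) ∧
      (∀ q ∈ Icc s T,
        Memℓp (fun n => SigKernel.signature s T (SigKernel.lift H τ) n q) 2) ∧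
      ContinuousOn (fun p : ℝ × ℝ => SigKernel.liftedKernel H T t s τ γ p.1 p.2)
        (Icc t T ×ˢ Icc s T)) ∧
    -- first derivative
    (∀ η : ℝ → SigKernel.V e, SigKernel.IsBVPath t T η →
      (∀ u ∈ Icc t T, LineDifferentiableAt ℝ (fun γ' => SigKernel.lift H γ' u) γ η) ∧
      SigKernel.IsBVPath t T (SigKernel.dLift H η γ) ∧
      (∀ r ∈ Icc t T, ∀ q ∈ Icc s T,
        LineDifferentiableAt ℝ (fun γ' => SigKernel.liftedKernel H T t s τ γ' r q) γ η) ∧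
      ContinuousOn (fun p : ℝ × ℝ => SigKernel.dLiftedKernel H T t s τ η γ p.1 p.2)
        (Icc t T ×ˢ Icc s T) ∧
      ∀ r ∈ Icc t T, ∀ q ∈ Icc s T,
        SigKernel.dLiftedKernel H T t s τ η γ r q =
          SigKernel.doubleIntegral T t s (SigKernel.dLiftedKernel H T t s τ η γ)
              (SigKernel.lift H γ) (SigKernel.lift H τ) r q
          + SigKernel.doubleIntegral T t s (SigKernel.liftedKernel H T t s τ γ)
              (SigKernel.dLift H η γ) (SigKernel.lift H τ) r q) ∧
    -- second derivative
    (∀ η η' : ℝ → SigKernel.V e, SigKernel.IsBVPath t T η → SigKernel.IsBVPath t T η' →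
      (∀ u ∈ Icc t T, LineDifferentiableAt ℝ (fun γ' => SigKernel.dLift H η γ' u) γ η') ∧
      SigKernel.IsBVPath t T (SigKernel.ddLift H η η' γ) ∧
      (∀ r ∈ Icc t T, ∀ q ∈ Icc s T,
        LineDifferentiableAt ℝ (fun γ' => SigKernel.dLiftedKernel H T t s τ η γ' r q) γ η') ∧
      ContinuousOn (fun p : ℝ × ℝ => SigKernel.ddLiftedKernel H T t s τ η η' γ p.1 p.2)
        (Icc t T ×ˢ Icc s T) ∧
      ∀ r ∈ Icc t T, ∀ q ∈ Icc s T,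
        SigKernel.ddLiftedKernel H T t s τ η η' γ r q =
          SigKernel.doubleIntegral T t s (SigKernel.ddLiftedKernel H T t s τ η η' γ)
              (SigKernel.lift H γ) (SigKernel.lift H τ) r q
          + SigKernel.doubleIntegral T t s (SigKernel.dLiftedKernel H T t s τ η γ)
              (SigKernel.dLift H η' γ) (SigKernel.lift H τ) r q
          + SigKernel.doubleIntegral T t s (SigKernel.dLiftedKernel H T t s τ η' γ)
              (SigKernel.dLift H η γ) (SigKernel.lift H τ) r q
          + SigKernel.doubleIntegral T t s (SigKernel.liftedKernel H T t s τ γ)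
              (SigKernel.ddLift H η η' γ) (SigKernel.lift H τ) r q) := by
  have htT : t ≤ T := ht.2
  have hsT : s ≤ T := hs.2
  obtain ⟨C, φ', φ'', D⟩ := hg.exists_isFeatureDeriv (H := H) hH
  refine ⟨⟨D.isBVPath_lift hγ, D.isBVPath_lift hτ,
    fun r hr => SigKernel.memℓp_signature (D.isBVPath_lift hγ) hr,
    fun q hq => SigKernel.memℓp_signature (D.isBVPath_lift hτ) hq,
    SigKernel.continuousOn_of_eq htT hsT (SigKernel.liftedKernel_eq D htT hsT hτ hγ)⟩,
    fun η hη => ⟨fun u _ => (D.hasLineDerivAt_lift γ η u).lineDifferentiableAt,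
      D.isBVPath_dLift hη hγ, fun r hr q hq => ?_,
      SigKernel.continuousOn_of_eq htT hsT (SigKernel.dLiftedKernel_eq D htT hsT hτ hγ hη),
      fun r hr q hq => ?_⟩,
    fun η η' hη hη' => ⟨fun u _ => (D.hasLineDerivAt_dLift γ η η' u).lineDifferentiableAt,
      D.isBVPath_ddLift hη hη' hγ, fun r hr q hq => ?_,
      SigKernel.continuousOn_of_eq htT hsT
        (SigKernel.ddLiftedKernel_eq D htT hsT hτ hγ hη hη'),
      fun r hr q hq => ?_⟩⟩
  · exact (SigKernel.hasLineDerivAt_liftedKernel D htT hsT hτ hγ hη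
      (⟨r, hr⟩, ⟨q, hq⟩)).lineDifferentiableAt
  · exact SigKernel.dLiftedKernel_eq_doubleIntegral D htT hsT hτ hγ hη (⟨r, hr⟩, ⟨q, hq⟩)
  · exact (SigKernel.hasLineDerivAt_dLiftedKernel D htT hsT hτ hγ hη hη'
      (⟨r, hr⟩, ⟨q, hq⟩)).lineDifferentiableAt
  · exact SigKernel.ddLiftedKernel_eq_doubleIntegral D htT hsT hτ hγ hη hη' (⟨r, hr⟩, ⟨q, hq⟩)
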